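/- **Setting.** Let $T>0$, let $M\ge 0$ be an integer, let $\mathbb{D}\in\mathbb{R}^{M\times M}$ be a constant matrix such that $\mathbb{D}+\mathbb{D}^T$ is negative semidefinite, and let $\mathbf{R}\in[L^2(0,T)]^M$ and $\mathbf{Y}_0\in\mathbb{R}^M$. Let $\mathbf{Y}$ be the (absolutely continuous) solution of $$\mathbf{Y}'(t)=\mathbb{D}\mathbf{Y}(t)+\mathbf{R}(t)\ \text{ for a.e. } t\in(0,T),\qquad \mathbf{Y}(0)=\mathbf{Y}_0 .$$ Let $0=t_0<t_1<\cdots<t_N=T$, $I_n=(t_n,t_{n+1})$, and $\tau=\max_{0\le n\le N-1}(t_{n+1}-t_n)$. For an integer $m\ge 0$ let $P^m$ be the polynomials of degree at most $m$, and let $\mathcal{P}_m$ be the local $L^2$ projection: on each $I_n$, $\mathcal{P}_m\mathbf{v}\in[P^m]^M$ and $\int_{I_n}(\mathcal{P}_m\mathbf{v},\mathbf{w})\,dt=\int_{I_n}(\mathbf{v},\mathbf{w})\,dt$ for all $\mathbf{w}\in[P^m]^M$. For an integer $r\ge 1$ let $\mathbf{Y}_r$ be the solution of the continuous time Galerkin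 method: $\mathbf{Y}_r$ is continuous on $[0,T]$, $\mathbf{Y}_r|_{I_n}\in[P^r]^M$ for each $n$, $\mathbf{Y}_r(0)=\mathbf{Y}_0$, and $$\mathbf{Y}_r'=\mathbb{D}\mathcal{P}_{r-1}\mathbf{Y}_r+\mathcal{P}_{r-1}\mathbf{R}\quad\text{in } I_n,\qquad 0\le n\le N-1 .$$ For real $s\ge 0$ the norm of $H^s(0,T)$ is given by $$\|\mathbf{v}\|_{H^s(0,T)}^2=\sum_{j=0}^{\lfloor s\rfloor}\|\mathbf{v}^{(j)}\|_{L^2(0,T)}^2+|\mathbf{v}|_*^2$$ with weak derivatives $\mathbf{v}^{(j)}$, where $|\mathbf{v}|_*=0$ if $s$ is an integer, and otherwise, with $\sigma=s-\lfloor s\rfloor$ and $\mathbf{g}=\mathbf{v}^{(\lfloor s\rfloor)}$, $$|\mathbf{v}|_*^2=\int_0^T\!\!\int_0^T\frac{\|\mathbf{g}(x)-\mathbf{g}(y)\|^2}{|x-y|^{1+2\sigma}}\,dx\,dy .$$ Throughout, $\|\cdot\|$ is the Euclidean norm of $\mathbb{R}^M$. **Theorem ($hp$ superconvergence at the nodes).**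 For every real $s\ge 1$ there is a constant $C>0$ depending only on $s$ (in particular independent of $r$, $\tau$, the partition, $T$, $M$, $\mathbb{D}$, $\mathbf{R}$ and $\mathbf{Y}_0$) such that, in the setting above, if $\mathbb{D}^r\mathbf{Y}\in[H^s(0,T)]^M$, then $$\max_{1\le n\le N}\|(\mathbf{Y}-\mathbf{Y}_r)(t_n)\|\le C\,T^{1/2}\,\frac{\tau^{\min(2r,\,s+r-1)}}{r^{s}}\,\|\mathbb{D}^r\mathbf{Y}\|_{H^s(0,T)} .$$ -/

import Mathlib

open MeasureTheory Set

open scoped ENNReal ContDiff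

noncomputable section

section Sobolev

variable {E : Type*} [NormedAddCommGroup E] [NormedSpace ℝ E]

/-- `g` is a weak derivative of order `k` of `u` on the open interval `(a, b)`:
`∫ φ⁽ᵏ⁾ u = (-1)ᵏ ∫ φ g` for all test functions `φ ∈ C_c^∞(a, b)`. -/
def IsWeakDeriv (a b : ℝ) (k : ℕ) (u g : ℝ → E) : Prop :=
  LocallyIntegrableOn u (Ioo a b) ∧ LocallyIntegrableOn g (Ioo a b) ∧
    ∀ φ : ℝ → ℝ, ContDiff ℝ ∞ φ → HasCompactSupport φ → tsupport φ ⊆ Ioo a b →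
      ∫ x in Ioo a b, iteratedDeriv k φ x • u x = (-1 : ℝ) ^ k • ∫ x in Ioo a b, φ x • g x

open Classical in
/-- The weak derivative `D^k u` on `(a, b)`. It is unique up to null sets; a representative is
chosen when it exists (and the value is `0` otherwise). -/
def weakDeriv (a b : ℝ) (k : ℕ) (u : ℝ → E) : ℝ → E :=
  if h : ∃ g, IsWeakDeriv a b k u g then h.choose else 0

/-- The squared Gagliardo (Sobolev–Slobodeckij) seminorm of order `σ ∈ (0, 1)` on `(a, b)`:
`∬ |g(x) - g(y)|² / |x - y|^{1 + 2σ} dx dy`. -/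
def gagliardoSq (a b σ : ℝ) (g : ℝ → E) : ℝ≥0∞ :=
  ∫⁻ x in Ioo a b, ∫⁻ y in Ioo a b,
    ENNReal.ofReal (‖g x - g y‖ ^ 2 / |x - y| ^ (1 + 2 * σ))

/-- `u ∈ H^s(a, b)` for a real number `s ≥ 0`: the weak derivatives of order `j ≤ ⌊s⌋` exist
and lie in `L²(a, b)`, and if `s` is not an integer then the Gagliardo seminorm of order
`s - ⌊s⌋` of the derivative of order `⌊s⌋` is finite. -/
def MemHs (a b s : ℝ) (u : ℝ → E) : Prop :=
  (∀ j : ℕ, j ≤ ⌊s⌋₊ → (∃ g, IsWeakDeriv a b j u g) ∧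
    MemLp (weakDeriv a b j u) 2 (volume.restrict (Ioo a b))) ∧
  (Int.fract s ≠ 0 → gagliardoSq a b (Int.fract s) (weakDeriv a b ⌊s⌋₊ u) < (⊤ : ℝ≥0∞))

open Classical in
/-- The norm of `H^s(a, b)`, `s ≥ 0` (meaningful for `u` with `MemHs a b s u`):
the square root of `∑_{j ≤ ⌊s⌋} ‖D^j u‖²_{L²(a, b)}`, plus the squared Gagliardo seminorm of
order `s - ⌊s⌋` of `D^{⌊s⌋} u` if `s` is not an integer. -/
def hsNorm (a b s : ℝ) (u : ℝ → E) : ℝ :=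
  √((∑ j ∈ Finset.range (⌊s⌋₊ + 1), ∫ x in Ioo a b, ‖weakDeriv a b j u x‖ ^ 2) +
    if Int.fract s = 0 then 0
    else (gagliardoSq a b (Int.fract s) (weakDeriv a b ⌊s⌋₊ u)).toReal)

end Sobolev

/-- `Y` solves `Y' = D Y + R` in `(0, T)`, `Y(0) = Y₀`: it is absolutely continuous on `[0, T]`,
takes the initial value, and satisfies the equation almost everywhere. -/
def IsODESolution {M : ℕ} (T : ℝ) (D : Matrix (Fin M) (Fin M) ℝ)
    (R : ℝ → EuclideanSpace ℝ (Fin M)) (Y₀ : EuclideanSpace ℝ (Fin M))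
    (Y : ℝ → EuclideanSpace ℝ (Fin M)) : Prop :=
  AbsolutelyContinuousOnInterval Y 0 T ∧ Y 0 = Y₀ ∧
    ∀ᵐ x ∂(volume.restrict (Ioo 0 T)), HasDerivAt Y (D.toEuclideanLin (Y x) + R x) x

/-- `0 = t₀ < t₁ < ⋯ < t_N = T`. -/
def IsPartition {N : ℕ} (T : ℝ) (t : Fin (N + 1) → ℝ) : Prop :=
  StrictMono t ∧ t 0 = 0 ∧ t (Fin.last N) = T

/-- The largest time step `τ = max_n (t_{n+1} - t_n)`. -/
def maxStep {N : ℕ} (t : Fin (N + 1) → ℝ) : ℝ :=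
  ⨆ n : Fin N, (t n.succ - t n.castSucc)

/-- `p ∈ [P^m]^M`: `p` is a vector-valued polynomial function of degree at most `m`. -/
def IsVecPoly {M : ℕ} (m : ℕ) (p : ℝ → EuclideanSpace ℝ (Fin M)) : Prop :=
  ∃ c : ℕ → EuclideanSpace ℝ (Fin M), ∀ x, p x = ∑ j ∈ Finset.range (m + 1), x ^ j • c j

/-- The space `V_τ^m` of continuous functions on `[0, T]` that are polynomials of degree at
most `m` on each interval `I_n = (t_n, t_{n+1})`. -/
def MemV {M N : ℕ} (T : ℝ) (t : Fin (N + 1) → ℝ) (m : ℕ)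
    (v : ℝ → EuclideanSpace ℝ (Fin M)) : Prop :=
  ContinuousOn v (Icc 0 T) ∧
    ∀ n : Fin N, ∃ p : ℝ → EuclideanSpace ℝ (Fin M), IsVecPoly m p ∧
      EqOn v p (Ioo (t n.castSucc) (t n.succ))

/-- `p = 𝒫_m v` on `(a, b)`: `p ∈ [P^m]^M` and `∫ (p, w) = ∫ (v, w)` for all `w ∈ [P^m]^M`. -/
def IsLocalProj {M : ℕ} (a b : ℝ) (m : ℕ) (v p : ℝ → EuclideanSpace ℝ (Fin M)) : Prop :=
  IsVecPoly m p ∧ ∀ w : ℝ → EuclideanSpace ℝ (Fin M), IsVecPoly m w →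
    ∫ x in Ioo a b, inner ℝ (p x) (w x) = ∫ x in Ioo a b, inner ℝ (v x) (w x)

/-- `Z` solves the continuous time Galerkin method of degree `r`: `Z ∈ V_τ^r`, `Z(0) = Y₀` and
`Z' = D 𝒫_{r-1} Z + 𝒫_{r-1} R` in each `I_n`. -/
def IsCTGSolution {M N : ℕ} (T : ℝ) (t : Fin (N + 1) → ℝ) (r : ℕ)
    (D : Matrix (Fin M) (Fin M) ℝ) (R : ℝ → EuclideanSpace ℝ (Fin M))
    (Y₀ : EuclideanSpace ℝ (Fin M)) (Z : ℝ → EuclideanSpace ℝ (Fin M)) : Prop :=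
  MemV T t r Z ∧ Z 0 = Y₀ ∧
    ∀ n : Fin N, ∃ p q : ℝ → EuclideanSpace ℝ (Fin M),
      IsLocalProj (t n.castSucc) (t n.succ) (r - 1) Z p ∧
      IsLocalProj (t n.castSucc) (t n.succ) (r - 1) R q ∧
      ∀ x ∈ Ioo (t n.castSucc) (t n.succ),
        HasDerivAt Z (D.toEuclideanLin (p x) + q x) x

end

/-! The proof is a duality argument on each step `[a, b]`, with `h = b - a`, `A` the operator of the
equation and `e = Y - Y_r`. Let `K_0 = 1, K_1, …, K_{2r}` satisfy `K_{l+1}' = K_l`, with `K_r` a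
multiple of the Legendre polynomial of degree `r`. Put `c_i = (-A*)^i G`. Since `K_r` is orthogonal
to `P^{r-1}`, the polynomial `Φ = Σ_{i ≤ r} K_i c_i` satisfies `Φ' = -A* 𝒫_{r-1} Φ`, so it solves
the discrete adjoint problem exactly. Testing the error equation with `Φ` makes all terms cancel
except (`galerkin_step_identity`) `(e, Φ)(b) - (e, Φ)(a) = ∫ (Y', c_r) K_r = ± ∫ ((A^r Y)', G) K_r`.
This is how the powers of the matrix in the norm on the right arise.

Choose `G` so that `Φ(b) = e(b)`. The sign of the symmetric part gives `‖Φ(a)‖ ≤ ‖Φ(b)‖`, so the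
step errors merely add up (`galerkin_step_error`). Two quantities remain to be bounded.

The first is `‖G‖` in terms of `‖Φ(b)‖`, uniformly in `A` and `h` (`norm_le_adjConst_mul`). An
energy estimate bounds `𝒫_{r-1} Φ` in `L²`. Pairing it with Legendre polynomials bounds each `c_j`
by the later ones, and a discrete Gronwall argument yields a factor `5 (3/2)^r √((2r-2)! r)`.

The second is the remaining integral. As `K_r` is the `m`-th derivative of `K_{r+m}`, and `K_{r+1},
…, K_{2r}` vanish at both endpoints, `m ≤ r` derivatives can be moved to the data. In the fractional
case `K_{r+m}` has mean zero, which brings in the Gagliardo seminorm. The `L²` norm of `K_{r+m}`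
carries `h^{r+m+1/2} / √((2r)!)`.

The factorials cancel (`adjConst_mul_sqrt_le`) and leave `5 (3/4)^r`, which decays faster than
`r^{-s}`. Cauchy–Schwarz over the steps gives `√T` times the global norm. -/

/-! ### Legendre polynomials, their iterated primitives and derivatives on `[-1, 1]`. -/

section LegendrePolynomials

open Polynomial

/-- The Legendre weight `(X² - 1)^j`. -/
noncomputable def legW (j : ℕ) : ℝ[X] := (X ^ 2 - 1) ^ j

/-- For `l = r` the Legendre polynomial of degree `r` normalized to have leading coefficient
`1 / r!`; in general the polynomial of degree `l` with leading coefficient `1 / l!` in the chain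
of its derivatives (`l < r`) and iterated primitives (`l > r`). -/
noncomputable def legK (r l : ℕ) : ℝ[X] := C ((2 * r).factorial : ℝ)⁻¹ * derivative^[2 * r - l] (legW r)

lemma legW_monic (j : ℕ) : (legW j).Monic := by
  have : (X ^ 2 - 1 : ℝ[X]).Monic := by
    simpa using monic_X_pow_sub_C (1 : ℝ) (n := 2) (by norm_num)
  exact this.pow j

lemma natDegree_legW (j : ℕ) : (legW j).natDegree = 2 * j := by
  have : (X ^ 2 - 1 : ℝ[X]).natDegree = 2 := by
    simpa using natDegree_X_pow_sub_C (R := ℝ) (n := 2) (r := 1)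
  rw [legW, natDegree_pow, this, mul_comm]

lemma iterate_derivative_legW (j : ℕ) :
    derivative^[2 * j] (legW j) = C ((2 * j).factorial : ℝ) := by
  have h0 : (derivative^[2 * j] (legW j)).natDegree = 0 := by
    have := natDegree_iterate_derivative (legW j) (2 * j)
    rw [natDegree_legW] at this
    omega
  rw [eq_C_of_natDegree_eq_zero h0, coeff_iterate_derivative]
  have h1 : (legW j).coeff (2 * j) = 1 := by
    have := (legW_monic j).coeff_natDegree
    rwa [natDegree_legW] at this
  simp [h1, Nat.descFactorial_self]

lemma legK_zero (r : ℕ) : legK r 0 = 1 := by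
  rw [legK, Nat.sub_zero, iterate_derivative_legW, ← C_mul, inv_mul_cancel₀, C_1]
  exact_mod_cast (Nat.factorial_pos _).ne'

lemma derivative_legK_succ {r l : ℕ} (h : l + 1 ≤ 2 * r) :
    derivative (legK r (l + 1)) = legK r l := by
  rw [legK, derivative_C_mul, ← Function.iterate_succ_apply' derivative, legK]
  congr 3
  omega

lemma iterate_derivative_legK {r j l : ℕ} (hjl : j ≤ l) (h : l ≤ 2 * r) :
    derivative^[j] (legK r l) = legK r (l - j) := by
  induction j with
  | zero => simp
  | succ j ih =>
    rw [Function.iterate_succ_apply', ih (by omega),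
      show l - j = (l - (j + 1)) + 1 by omega, derivative_legK_succ (by omega)]

lemma natDegree_legK_le {r l : ℕ} (h : l ≤ 2 * r) : (legK r l).natDegree ≤ l := by
  refine (natDegree_C_mul_le _ _).trans ((natDegree_iterate_derivative _ _).trans ?_)
  rw [natDegree_legW]
  omega

lemma iterate_derivative_legK_eq_zero {r j l : ℕ} (hjl : l < j) (h : l ≤ 2 * r) :
    derivative^[j] (legK r l) = 0 :=
  iterate_derivative_eq_zero ((natDegree_legK_le h).trans_lt hjl)

lemma legW_comp_neg (j : ℕ) : (legW j).comp (-X) = legW j := by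
  simp [legW]

lemma legK_comp_neg {r l : ℕ} (h : l ≤ 2 * r) :
    (legK r l).comp (-X) = (-1 : ℝ[X]) ^ l * legK r l := by
  have key : ∀ k, (derivative^[k] (legW r)).comp (-X) =
      (-1 : ℝ[X]) ^ k * derivative^[k] (legW r) := by
    intro k
    induction k with
    | zero => simp [legW_comp_neg]
    | succ k ih =>
      have h2 := congrArg derivative ih
      rw [derivative_comp, derivative_neg, derivative_X] at h2
      have h3 : derivative ((-1 : ℝ[X]) ^ k * derivative^[k] (legW r)) =
          (-1 : ℝ[X]) ^ k * derivative (derivative^[k] (legW r)) := by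
        rw [show (-1 : ℝ[X]) ^ k = C ((-1 : ℝ) ^ k) by simp, derivative_C_mul]
      rw [h3] at h2
      rw [Function.iterate_succ_apply', pow_succ]
      linear_combination (-1 : ℝ[X]) * h2
  rw [legK, mul_comp, key, C_comp]
  have : (-1 : ℝ[X]) ^ (2 * r - l) = (-1) ^ l :=
    neg_one_pow_congr (by rw [Nat.even_sub h]; simp)
  rw [this]
  ring

lemma eval_neg_legK {r l : ℕ} (h : l ≤ 2 * r) (x : ℝ) :
    (legK r l).eval (-x) = (-1) ^ l * (legK r l).eval x := by
  have := congrArg (eval x) (legK_comp_neg h)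
  simpa [eval_comp] using this

lemma abs_coeff_legW_le (r k : ℕ) (hk : k ≤ r) :
    |(legW r).coeff (2 * r - 2 * k)| = r.choose k := by
  have : legW r = expand ℝ 2 ((X + C (-1)) ^ r) := by
    simp [legW, sub_eq_add_neg]
  rw [this, show 2 * r - 2 * k = (r - k) * 2 by omega, coeff_expand_mul (by norm_num),
    coeff_X_add_C_pow]
  rw [abs_mul, abs_pow, abs_neg, abs_one, one_pow, one_mul, Nat.choose_symm hk]
  simp

/-- One term of Vandermonde's identity gives `C(r,k)² ≤ C(2r,2k)`; the factor 2 comes from `(2k)! ≥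
2`. -/
lemma two_mul_factorial_mul_choose_le {r k : ℕ} (hk : 1 ≤ k) (hkr : k ≤ r) :
    2 * ((2 * r - 2 * k).factorial * r.choose k) ≤ (2 * r).factorial := by
  have h1 : r.choose k * r.choose k ≤ (2 * r).choose (2 * k) := by
    rw [two_mul r, Nat.add_choose_eq]
    exact Finset.single_le_sum (f := fun ij : ℕ × ℕ => r.choose ij.1 * r.choose ij.2)
      (a := (k, k)) (fun _ _ => Nat.zero_le _) (by simp [two_mul])
  have h2 : r.choose k ≤ (2 * r).choose (2 * k) :=
    (Nat.le_mul_of_pos_left _ (Nat.choose_pos hkr)).trans h1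
  have h3 : 2 ≤ (2 * k).factorial := by
    simpa using Nat.factorial_le (show 2 ≤ 2 * k by omega)
  rw [← Nat.choose_mul_factorial_mul_factorial (show 2 * k ≤ 2 * r by omega)]
  calc 2 * ((2 * r - 2 * k).factorial * r.choose k)
      = r.choose k * 2 * (2 * r - 2 * k).factorial := by ring
    _ ≤ _ := by gcongr

lemma abs_eval_zero_legK_le {r k : ℕ} (hk : 1 ≤ k) (hkr : k ≤ r) :
    |(legK r (2 * k)).eval 0| ≤ 1 / 2 := by
  rw [← coeff_zero_eq_eval_zero, legK, coeff_C_mul, coeff_iterate_derivative, zero_add,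
    Nat.descFactorial_self, nsmul_eq_mul, abs_mul, abs_mul, abs_coeff_legW_le r k hkr, abs_inv,
    Nat.abs_cast, Nat.abs_cast]
  have h := two_mul_factorial_mul_choose_le hk hkr
  have h' : (2 : ℝ) * (((2 * r - 2 * k).factorial : ℝ) * r.choose k) ≤ (2 * r).factorial := by
    exact_mod_cast h
  have hp : (0 : ℝ) < (2 * r).factorial := by exact_mod_cast Nat.factorial_pos _
  rw [inv_mul_le_iff₀ hp]
  linarith

/-- If `p'' = q`, `p'(0) = 0` and `|q| ≤ 1` on `[0, 1]` then `|p(x) - p(0)| ≤ 1 / 2` there. -/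
lemma abs_eval_sub_eval_zero_le {p : ℝ[X]} (h0 : (derivative p).eval 0 = 0)
    (h : ∀ x ∈ Icc (0 : ℝ) 1, |(derivative (derivative p)).eval x| ≤ 1) {x : ℝ}
    (hx : x ∈ Icc (0 : ℝ) 1) : |p.eval x - p.eval 0| ≤ 1 / 2 := by
  -- A one-sided bound, proved by two monotonicity arguments (`q' ≤ x`, then `q - q(0) ≤ x²/2`),
  -- suffices: it is applied to `p` and to `-p`.
  have aux : ∀ q : ℝ[X], (∀ x ∈ Icc (0 : ℝ) 1, (derivative (derivative q)).eval x ≤ 1) →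
      (derivative q).eval 0 = 0 → q.eval x - q.eval 0 ≤ 1 / 2 := by
    intro q hq hq0
    have h1 : ∀ y ∈ Icc (0 : ℝ) 1, (derivative q).eval y ≤ y := by
      intro y hy
      have hanti : AntitoneOn (fun z => (derivative q).eval z - z) (Icc 0 1) := by
        refine antitoneOn_of_deriv_nonpos (convex_Icc _ _) (by fun_prop) (by fun_prop) ?_
        intro z hz
        rw [interior_Icc] at hz
        have := hq z ⟨hz.1.le, hz.2.le⟩
        have hd : HasDerivAt (fun z => (derivative q).eval z - z)
            ((derivative (derivative q)).eval z - 1) z :=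
          ((derivative q).hasDerivAt z).sub (hasDerivAt_id z)
        rw [hd.deriv]
        linarith
      have := hanti (left_mem_Icc.2 zero_le_one) hy hy.1
      simp only [hq0] at this
      linarith
    have hanti : AntitoneOn (fun z => q.eval z - z ^ 2 / 2) (Icc 0 1) := by
      refine antitoneOn_of_deriv_nonpos (convex_Icc _ _) (by fun_prop) (by fun_prop) ?_
      intro z hz
      rw [interior_Icc] at hz
      have := h1 z ⟨hz.1.le, hz.2.le⟩
      have hd : HasDerivAt (fun z => q.eval z - z ^ 2 / 2)
          ((derivative q).eval z - z) z := by
        refine ((q).hasDerivAt z).sub ?_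
        have := ((hasDerivAt_id z).pow 2).div_const 2
        simpa using this
      rw [hd.deriv]
      linarith
    have := hanti (left_mem_Icc.2 zero_le_one) hx hx.1
    simp only at this
    nlinarith [hx.1, hx.2]
  rw [abs_le]
  have h2 := aux (-p) (fun y hy => by have := (abs_le.1 (h y hy)).1; simp; linarith) (by simp [h0])
  simp only [eval_neg] at h2
  exact ⟨by linarith, aux p (fun y hy => (abs_le.1 (h y hy)).2) h0⟩

/-- Induction in steps of two: `K_{2k+2}'' = K_{2k}`, and `K_{2k+2}'` is odd, so `K_{2k+2}` moves by
at most 1/2 away from its value at 0, which is itself at most 1/2 in modulus. Parity covers negative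
`x`. -/
lemma abs_eval_legK_two_mul_le {r k : ℕ} (hkr : k ≤ r) {x : ℝ} (hx : x ∈ Icc (-1 : ℝ) 1) :
    |(legK r (2 * k)).eval x| ≤ 1 := by
  have key : ∀ k, k ≤ r → ∀ x ∈ Icc (0 : ℝ) 1, |(legK r (2 * k)).eval x| ≤ 1 := by
    intro k
    induction k with
    | zero => intro _ x _; simp [legK_zero]
    | succ k ih =>
      intro hk x hx
      have hd : derivative (legK r (2 * (k + 1))) = legK r (2 * k + 1) :=
        derivative_legK_succ (l := 2 * k + 1) (by omega)
      have hd2 : derivative (derivative (legK r (2 * (k + 1)))) = legK r (2 * k) := by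
        rw [hd, derivative_legK_succ (by omega)]
      have h0 : (derivative (legK r (2 * (k + 1)))).eval 0 = 0 := by
        have h := eval_neg_legK (r := r) (l := 2 * k + 1) (by omega) 0
        rw [neg_zero, Odd.neg_one_pow ⟨k, rfl⟩] at h
        rw [hd]
        linarith
      have h1 := abs_eval_sub_eval_zero_le h0 (by rw [hd2]; exact ih (by omega)) hx
      have h2 := abs_eval_zero_legK_le (r := r) (k := k + 1) (by omega) hk
      have h3 := abs_sub_abs_le_abs_sub ((legK r (2 * (k + 1))).eval x)
        ((legK r (2 * (k + 1))).eval 0)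
      linarith
  rcases le_total 0 x with h | h
  · exact key k hkr x ⟨h, hx.2⟩
  · have := eval_neg_legK (r := r) (l := 2 * k) (by omega) x
    rw [Even.neg_one_pow (even_two_mul k), one_mul] at this
    rw [← this]
    exact key k hkr (-x) ⟨by linarith, by linarith [hx.1]⟩

lemma intervalIntegrable_eval (p : ℝ[X]) (a b : ℝ) :
    IntervalIntegrable (fun x => p.eval x) volume a b :=
  p.continuous.intervalIntegrable _ _

lemma integral_eval_mul_derivative (p q : ℝ[X]) (a b : ℝ) (ha : q.eval a = 0)
    (hb : q.eval b = 0) :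
    ∫ x in a..b, p.eval x * (derivative q).eval x =
      -∫ x in a..b, (derivative p).eval x * q.eval x := by
  rw [intervalIntegral.integral_mul_deriv_eq_deriv_mul (u := fun x => p.eval x)
    (v := fun x => q.eval x) (fun x _ => p.hasDerivAt x) (fun x _ => q.hasDerivAt x)
    (intervalIntegrable_eval _ _ _) (intervalIntegrable_eval _ _ _)]
  simp [ha, hb]

lemma eval_iterate_derivative_legW {i j : ℕ} (hij : i < j) {x : ℝ} (hx : x ^ 2 = 1) :
    (derivative^[i] (legW j)).eval x = 0 := by
  obtain ⟨q, hq⟩ := pow_sub_dvd_iterate_derivative_pow (X ^ 2 - 1 : ℝ[X]) j i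
  rw [legW, hq, eval_mul, eval_pow]
  simp [hx, zero_pow (show j - i ≠ 0 by omega)]

/-- Fewer than `r` derivatives of `(X² - 1)^r` leave a factor `X² - 1`. This removes every boundary
term when derivatives are moved off `K_r`. -/
lemma eval_legK_eq_zero {r l : ℕ} (hrl : r < l) (hl : l ≤ 2 * r) {x : ℝ} (hx : x ^ 2 = 1) :
    (legK r l).eval x = 0 := by
  rw [legK, eval_mul, eval_iterate_derivative_legW (by omega) hx, mul_zero]

/-- Repeated integration by parts against a derivative of the Legendre weight. -/
lemma integral_mul_iterate_derivative_legW {i j : ℕ} (hij : i ≤ j) (p : ℝ[X]) :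
    ∫ x in (-1 : ℝ)..1, p.eval x * (derivative^[j] (legW j)).eval x =
      (-1) ^ i * ∫ x in (-1 : ℝ)..1,
        (derivative^[i] p).eval x * (derivative^[j - i] (legW j)).eval x := by
  induction i with
  | zero => simp
  | succ i ih =>
    rw [ih (by omega), show j - i = (j - (i + 1)) + 1 by omega]
    simp only [Function.iterate_succ_apply']
    rw [integral_eval_mul_derivative _ _ _ _
      (eval_iterate_derivative_legW (by omega) (by norm_num))
      (eval_iterate_derivative_legW (by omega) (by norm_num)), pow_succ]
    ring

/-- Rodrigues' formula: `r` integrations by parts differentiate `p` to zero. -/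
lemma integral_mul_legK_self_eq_zero {r : ℕ} {p : ℝ[X]} (hp : p.natDegree < r) :
    ∫ x in (-1 : ℝ)..1, p.eval x * (legK r r).eval x = 0 := by
  have h : ∀ x, p.eval x * (legK r r).eval x =
      ((2 * r).factorial : ℝ)⁻¹ * (p.eval x * (derivative^[r] (legW r)).eval x) := by
    intro x
    rw [legK, show 2 * r - r = r by omega, eval_mul, eval_C]
    ring
  simp_rw [h]
  rw [intervalIntegral.integral_const_mul, integral_mul_iterate_derivative_legW le_rfl,
    iterate_derivative_eq_zero hp]
  simp

/-- The integral `∫ (1 - x²)^j` over `[-1, 1]`. -/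
noncomputable def legI (j : ℕ) : ℝ := ∫ x in (-1 : ℝ)..1, (1 - x ^ 2) ^ j

lemma eval_legW (j : ℕ) (x : ℝ) : (legW j).eval x = (-1) ^ j * (1 - x ^ 2) ^ j := by
  rw [legW, eval_pow, ← mul_pow]
  simp

lemma legI_le_two (j : ℕ) : legI j ≤ 2 := by
  have : legI j ≤ ∫ _ in (-1 : ℝ)..1, (1 : ℝ) := by
    refine intervalIntegral.integral_mono_on (by norm_num)
      (Continuous.intervalIntegrable (by fun_prop) _ _) (by simp) ?_
    intro x hx
    exact pow_le_one₀ (by nlinarith [hx.1, hx.2]) (by nlinarith [sq_nonneg x])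
  norm_num at this
  exact this

/-- On `[0, 1]` one has `1 - x² ≥ 1 - x`, whose `j`-th power is integrated explicitly. -/
lemma two_div_le_legI (j : ℕ) : 2 / (j + 1 : ℝ) ≤ legI j := by
  have hc : Continuous fun x : ℝ => (1 - x ^ 2) ^ j := by fun_prop
  have hsymm : ∫ x in (-1 : ℝ)..0, (1 - x ^ 2) ^ j = ∫ x in (0 : ℝ)..1, (1 - x ^ 2) ^ j := by
    have := intervalIntegral.integral_comp_neg (a := 0) (b := 1) fun x : ℝ => (1 - x ^ 2) ^ j
    simpa using this.symm
  have hsplit : legI j = 2 * ∫ x in (0 : ℝ)..1, (1 - x ^ 2) ^ j := by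
    rw [legI, ← intervalIntegral.integral_add_adjacent_intervals (b := 0)
      (hc.intervalIntegrable _ _) (hc.intervalIntegrable _ _), hsymm]
    ring
  have hle : ∫ x in (0 : ℝ)..1, (1 - x) ^ j ≤ ∫ x in (0 : ℝ)..1, (1 - x ^ 2) ^ j := by
    refine intervalIntegral.integral_mono_on (by norm_num)
      (Continuous.intervalIntegrable (by fun_prop) _ _) (hc.intervalIntegrable _ _) ?_
    intro x hx
    exact pow_le_pow_left₀ (by linarith [hx.2]) (by nlinarith [hx.1, hx.2]) _
  have hval : ∫ x in (0 : ℝ)..1, (1 - x) ^ j = 1 / (j + 1 : ℝ) := by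
    rw [intervalIntegral.integral_comp_sub_left (fun x : ℝ => x ^ j) 1, integral_pow]
    simp
  rw [hval] at hle
  rw [hsplit, show 2 / (j + 1 : ℝ) = 2 * (1 / (j + 1 : ℝ)) by ring]
  linarith

lemma legI_pos (j : ℕ) : 0 < legI j := lt_of_lt_of_le (by positivity) (two_div_le_legI j)

lemma integral_iterate_derivative_legW_sq (j : ℕ) :
    ∫ x in (-1 : ℝ)..1, (derivative^[j] (legW j)).eval x ^ 2 = (2 * j).factorial * legI j := by
  simp_rw [sq]
  rw [integral_mul_iterate_derivative_legW le_rfl, ← Function.iterate_add_apply, ← two_mul,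
    iterate_derivative_legW]
  simp only [eval_C, Nat.sub_self, Function.iterate_zero, id_eq, eval_legW]
  rw [intervalIntegral.integral_const_mul, intervalIntegral.integral_const_mul, legI]
  have : ((-1 : ℝ) ^ j) * (-1) ^ j = 1 := by rw [← mul_pow]; simp
  linear_combination ((2 * j).factorial : ℝ) *
    (∫ x in (-1 : ℝ)..1, (1 - x ^ 2) ^ j) * this

lemma integral_legK_self_sq_le (r : ℕ) :
    ∫ x in (-1 : ℝ)..1, (legK r r).eval x ^ 2 ≤ 2 / (2 * r).factorial := by
  have h : ∀ x, (legK r r).eval x ^ 2 =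
      (((2 * r).factorial : ℝ)⁻¹) ^ 2 * (derivative^[r] (legW r)).eval x ^ 2 := by
    intro x
    rw [legK, show 2 * r - r = r by omega, eval_mul, eval_C, mul_pow]
  simp_rw [h]
  rw [intervalIntegral.integral_const_mul, integral_iterate_derivative_legW_sq]
  have hp : (0 : ℝ) < (2 * r).factorial := by exact_mod_cast Nat.factorial_pos _
  rw [show (((2 * r).factorial : ℝ)⁻¹) ^ 2 * ((2 * r).factorial * legI r) =
    legI r / (2 * r).factorial by field_simp]
  gcongr
  exact legI_le_two r

/-- Since `|K_{2k}| ≤ 1`, an off-diagonal term in `norm_krylov_le` has coefficient no larger than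
the diagonal one, so the resulting recursion has unit coefficients. -/
lemma integral_even_legK_mul_weight_le {r j k : ℕ} (hk : k ≤ r) :
    |∫ x in (-1 : ℝ)..1, (legK r (2 * k)).eval x * (1 - x ^ 2) ^ j| ≤ legI j := by
  refine (intervalIntegral.abs_integral_le_integral_abs (by norm_num)).trans ?_
  refine intervalIntegral.integral_mono_on (by norm_num)
    (Continuous.intervalIntegrable ?_ _ _) (Continuous.intervalIntegrable (by fun_prop) _ _) ?_
  · exact ((legK r (2 * k)).continuous.mul (by fun_prop)).abs
  intro x hx
  have h0 : 0 ≤ (1 - x ^ 2) ^ j := pow_nonneg (by nlinarith [hx.1, hx.2]) _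
  rw [abs_mul, abs_of_nonneg h0]
  exact mul_le_of_le_one_left h0 (abs_eval_legK_two_mul_le hk hx)

lemma integral_odd_legK_mul_weight {r j l : ℕ} (hl : l ≤ 2 * r) (hodd : Odd l) :
    ∫ x in (-1 : ℝ)..1, (legK r l).eval x * (1 - x ^ 2) ^ j = 0 := by
  have h := intervalIntegral.integral_comp_neg (a := -1) (b := 1)
    fun x : ℝ => (legK r l).eval x * (1 - x ^ 2) ^ j
  simp only [eval_neg_legK hl, hodd.neg_one_pow, neg_sq, neg_neg] at h
  rw [show (fun x : ℝ => -1 * (legK r l).eval x * (1 - x ^ 2) ^ j) =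
    fun x => (-1) * ((legK r l).eval x * (1 - x ^ 2) ^ j) by ext; ring,
    intervalIntegral.integral_const_mul] at h
  linarith

/-- The Cauchy–Schwarz inequality for real functions. -/
lemma sq_integral_mul_le {α : Type*} [MeasurableSpace α] {μ : Measure α} {f g : α → ℝ}
    (hf : Integrable (fun x => f x ^ 2) μ) (hg : Integrable (fun x => g x ^ 2) μ)
    (hfg : Integrable (fun x => f x * g x) μ) :
    (∫ x, f x * g x ∂μ) ^ 2 ≤ (∫ x, f x ^ 2 ∂μ) * ∫ x, g x ^ 2 ∂μ := by
  have h : ∀ t : ℝ, 0 ≤ (∫ x, f x ^ 2 ∂μ) * (t * t) + (2 * ∫ x, f x * g x ∂μ) * t +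
      ∫ x, g x ^ 2 ∂μ := by
    intro t
    have h0 : 0 ≤ ∫ x, (t * f x + g x) ^ 2 ∂μ := integral_nonneg fun x => sq_nonneg _
    have h1 : ∀ x, (t * f x + g x) ^ 2 = (t * t) * f x ^ 2 + (2 * t) * (f x * g x) + g x ^ 2 :=
      fun x => by ring
    simp_rw [h1] at h0
    have h2 : Integrable (fun x => (t * t) * f x ^ 2 + (2 * t) * (f x * g x)) μ :=
      (hf.const_mul _).add (hfg.const_mul _)
    rw [integral_add h2 hg, integral_add (hf.const_mul _) (hfg.const_mul _),
      integral_const_mul, integral_const_mul] at h0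
    linarith
  have := discrim_le_zero h
  rw [discrim] at this
  nlinarith

lemma sq_intervalIntegral_mul_le {f g : ℝ → ℝ} {a b : ℝ} (hab : a ≤ b) (hf : Continuous f)
    (hg : Continuous g) :
    (∫ x in a..b, f x * g x) ^ 2 ≤ (∫ x in a..b, f x ^ 2) * ∫ x in a..b, g x ^ 2 := by
  simp only [intervalIntegral.integral_of_le hab]
  have hi : ∀ u : ℝ → ℝ, Continuous u → Integrable u (volume.restrict (Ioc a b)) := by
    intro u hu
    exact (hu.integrableOn_Icc (a := a) (b := b)).mono_set Ioc_subset_Icc_self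
  exact sq_integral_mul_le (hi _ (by fun_prop)) (hi _ (by fun_prop)) (hi _ (by fun_prop))

/-- A Poincaré inequality on `[-1, 1]` for polynomials vanishing at `-1`. -/
lemma integral_sq_le_of_eval_neg_one {p : ℝ[X]} (h : p.eval (-1) = 0) :
    ∫ x in (-1 : ℝ)..1, p.eval x ^ 2 ≤ 4 * ∫ x in (-1 : ℝ)..1, (derivative p).eval x ^ 2 := by
  set S := ∫ x in (-1 : ℝ)..1, (derivative p).eval x ^ 2
  have hcont : Continuous fun x => (derivative p).eval x ^ 2 :=
    (derivative p).continuous.pow 2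
  have hS : 0 ≤ S := intervalIntegral.integral_nonneg (by norm_num) fun x _ => sq_nonneg _
  have hpt : ∀ x ∈ Icc (-1 : ℝ) 1, p.eval x ^ 2 ≤ 2 * S := by
    intro x hx
    have h1 : ∫ y in (-1 : ℝ)..x, (1 : ℝ) * (derivative p).eval y = p.eval x := by
      simp_rw [one_mul]
      rw [intervalIntegral.integral_eq_sub_of_hasDerivAt (fun y _ => p.hasDerivAt y)
        (intervalIntegrable_eval _ _ _), h, sub_zero]
    have h2 := sq_intervalIntegral_mul_le hx.1 (continuous_const (y := (1 : ℝ)))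
      (derivative p).continuous
    rw [h1] at h2
    have h3 : ∫ y in (-1 : ℝ)..x, (derivative p).eval y ^ 2 ≤ S := by
      refine intervalIntegral.integral_mono_interval le_rfl hx.1 hx.2 ?_
        (hcont.intervalIntegrable _ _)
      exact Filter.Eventually.of_forall fun y => sq_nonneg _
    have h4 : ∫ y in (-1 : ℝ)..x, (1 : ℝ) ^ 2 = x + 1 := by simp
    rw [h4] at h2
    have h5 : 0 ≤ ∫ y in (-1 : ℝ)..x, (derivative p).eval y ^ 2 :=
      intervalIntegral.integral_nonneg hx.1 fun y _ => sq_nonneg _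
    nlinarith [hx.1, hx.2]
  have := intervalIntegral.integral_mono_on (a := -1) (b := 1) (μ := volume) (by norm_num)
    ((p.continuous.pow 2).intervalIntegrable _ _) (by simp) hpt
  rw [intervalIntegral.integral_const] at this
  norm_num at this
  linarith

/-- Each primitive beyond `K_r` vanishes at `-1` and costs one Poincaré factor 4. -/
lemma integral_legK_sq_le {r m : ℕ} (hm : m ≤ r) :
    ∫ x in (-1 : ℝ)..1, (legK r (r + m)).eval x ^ 2 ≤ 4 ^ m * (2 / (2 * r).factorial) := by
  induction m with
  | zero => simpa using integral_legK_self_sq_le r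
  | succ m ih =>
    have h := integral_sq_le_of_eval_neg_one (p := legK r (r + m + 1))
      (eval_legK_eq_zero (by omega) (by omega) (by norm_num))
    rw [derivative_legK_succ (by omega)] at h
    have := ih (by omega)
    rw [pow_succ, ← add_assoc]
    linarith

end LegendrePolynomials

/-! ### The discrete adjoint problem on `[-1, 1]`: explicit solution, stability and solvability. -/

section DiscreteAdjoint

open Polynomial

variable {E : Type*} [NormedAddCommGroup E] [InnerProductSpace ℝ E]

/-- The polynomial function `∑_{i < n} K_i(x) c_i` with vector coefficients. -/
noncomputable def legSum (r n : ℕ) (c : ℕ → E) (x : ℝ) : E :=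
  ∑ i ∈ Finset.range n, (legK r i).eval x • c i

lemma continuous_legSum (r n : ℕ) (c : ℕ → E) : Continuous (legSum r n c) :=
  continuous_finsetSum _ fun i _ => (legK r i).continuous.smul continuous_const

/-- The derivative of `legSum`. -/
noncomputable def legSumDeriv (r n : ℕ) (c : ℕ → E) (x : ℝ) : E :=
  ∑ i ∈ Finset.range n, (derivative (legK r i)).eval x • c i

lemma continuous_legSumDeriv (r n : ℕ) (c : ℕ → E) : Continuous (legSumDeriv r n c) :=
  continuous_finsetSum _ fun i _ => (derivative (legK r i)).continuous.smul continuous_const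

lemma hasDerivAt_legSum (r n : ℕ) (c : ℕ → E) (x : ℝ) :
    HasDerivAt (legSum r n c) (legSumDeriv r n c x) x :=
  HasDerivAt.fun_sum fun i _ => ((legK r i).hasDerivAt x).smul_const (c i)

/-- The scalar polynomial obtained by pairing `legSum` with a fixed vector. -/
noncomputable def legPair (r n : ℕ) (c : ℕ → E) (e : E) : ℝ[X] :=
  ∑ i ∈ Finset.range n, C (inner ℝ (c i) e) * legK r i

lemma eval_legPair (r n : ℕ) (c : ℕ → E) (e : E) (x : ℝ) :
    (legPair r n c e).eval x = inner ℝ (legSum r n c x) e := by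
  simp only [legPair, legSum, eval_finsetSum, sum_inner, eval_mul, eval_C, real_inner_smul_left]
  exact Finset.sum_congr rfl fun i _ => mul_comm _ _

lemma eval_derivative_legPair (r n : ℕ) (c : ℕ → E) (e : E) (x : ℝ) :
    (derivative (legPair r n c e)).eval x = inner ℝ (legSumDeriv r n c x) e := by
  simp only [legPair, legSumDeriv, derivative_sum, eval_finsetSum, sum_inner, eval_mul, eval_C,
    derivative_C_mul, real_inner_smul_left]
  exact Finset.sum_congr rfl fun i _ => mul_comm _ _

lemma natDegree_legPair_lt {r n : ℕ} (hn : 1 ≤ n) (hr : n ≤ 2 * r) (c : ℕ → E) (e : E) :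
    (legPair r n c e).natDegree < n := by
  refine Nat.lt_of_le_sub_one hn (natDegree_sum_le_of_forall_le _ _ fun i hi => ?_)
  rw [Finset.mem_range] at hi
  exact (natDegree_C_mul_le _ _).trans ((natDegree_legK_le (by omega)).trans (by omega))

/-- The Krylov sequence `B^i G`. -/
def krylov (B : E →ₗ[ℝ] E) (G : E) (i : ℕ) : E := (B ^ i) G

lemma krylov_succ (B : E →ₗ[ℝ] E) (G : E) (i : ℕ) : krylov B G (i + 1) = B (krylov B G i) := by
  simp [krylov, pow_succ']

/-- The function `∑_{i ≤ r} K_i B^i G` solves the discrete adjoint equation. -/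
lemma legSumDeriv_krylov {r : ℕ} (B : E →ₗ[ℝ] E) (G : E) (x : ℝ) :
    legSumDeriv r (r + 1) (krylov B G) x = B (legSum r r (krylov B G) x) := by
  rw [legSumDeriv, Finset.sum_range_succ', legSum, map_sum]
  simp only [legK_zero, derivative_one, eval_zero, zero_smul, add_zero, map_smul]
  refine Finset.sum_congr rfl fun i hi => ?_
  rw [Finset.mem_range] at hi
  rw [derivative_legK_succ (by omega), krylov_succ]

lemma legSum_succ (r : ℕ) (c : ℕ → E) (x : ℝ) :
    legSum r (r + 1) c x = legSum r r c x + (legK r r).eval x • c r :=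
  Finset.sum_range_succ _ _

lemma legSumDeriv_succ (r : ℕ) (c : ℕ → E) (x : ℝ) :
    legSumDeriv r (r + 1) c x = legSumDeriv r r c x + (derivative (legK r r)).eval x • c r :=
  Finset.sum_range_succ _ _

/-- Control of the projected discrete adjoint solution by its nodal value. -/
lemma integral_norm_sq_legSum_le {r : ℕ} (hr : 1 ≤ r) {B : E →ₗ[ℝ] E}
    (hB : ∀ x, 0 ≤ inner ℝ (B x) x) (G : E) :
    ∫ x in (-1 : ℝ)..1, ‖legSum r r (krylov B G) x‖ ^ 2 ≤
      2 * ‖legSum r (r + 1) (krylov B G) 1‖ ^ 2 := by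
  set c := krylov B G
  set a := c r
  set Ψ := legSum r r c
  set Ψd := legSumDeriv r r c
  set κ := fun x => (legK r r).eval x
  set κd := fun x => (derivative (legK r r)).eval x
  have hΨc : Continuous Ψ := continuous_legSum _ _ _
  have hΨdc : Continuous Ψd := continuous_legSumDeriv _ _ _
  have hκc : Continuous κ := (legK r r).continuous
  have hκdc : Continuous κd := (derivative (legK r r)).continuous
  have hBΨ : ∀ x, B (Ψ x) = Ψd x + κd x • a := fun x => by
    rw [← legSumDeriv_succ, legSumDeriv_krylov]
  -- This is the cofactor of `K_r` once the weighted energy below is differentiated; having degree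
  -- below `r`, it integrates to zero against `K_r`.
  set q : ℝ[X] := legPair r r c a + (1 + X) * derivative (legPair r r c a)
  have hdeg : q.natDegree < r := by
    have h1 := natDegree_legPair_lt (r := r) hr (by omega) c a
    refine lt_of_le_of_lt (natDegree_add_le _ _) (max_lt h1 ?_)
    by_cases h0 : derivative (legPair r r c a) = 0
    · rw [h0, mul_zero, natDegree_zero]; omega
    · have h2 : (legPair r r c a).natDegree ≠ 0 := fun h => h0 (derivative_of_natDegree_zero h)
      have h3 := natDegree_derivative_lt h2
      have h4 : (1 + X : ℝ[X]).natDegree ≤ 1 := by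
        rw [add_comm]; simpa using (natDegree_X_add_C (1 : ℝ)).le
      exact (natDegree_mul_le.trans (by omega)).trans_lt h1
  have hq : ∀ x, q.eval x = inner ℝ (Ψ x) a + (1 + x) * inner ℝ (Ψd x) a := fun x => by
    simp [q, eval_legPair, eval_derivative_legPair, Ψ, Ψd]
  -- The weight `1 + x` kills the value at `-1` and produces the term `‖Ψ‖² / 2` when
  -- differentiated.
  have hderiv : ∀ x, HasDerivAt
      (fun x => (1 + x) * (inner ℝ (Ψ x) (Ψ x) / 2 + κ x * inner ℝ (Ψ x) a))
      (‖Ψ x‖ ^ 2 / 2 + (1 + x) * inner ℝ (B (Ψ x)) (Ψ x) + q.eval x * κ x) x := by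
    intro x
    have hΨ : HasDerivAt Ψ (Ψd x) x := hasDerivAt_legSum _ _ _ _
    have hκ : HasDerivAt κ (κd x) x := (legK r r).hasDerivAt x
    have h1 : HasDerivAt (fun x : ℝ => 1 + x) 1 x := by
      simpa using (hasDerivAt_id x).const_add 1
    have h2 := (hΨ.inner ℝ hΨ).div_const 2
    have h3 := hκ.mul (hΨ.inner ℝ (hasDerivAt_const x a))
    refine (h1.mul (h2.add h3)).congr_deriv ?_
    rw [hq, hBΨ, inner_add_left, real_inner_smul_left, inner_zero_right,
      real_inner_comm (Ψ x) (Ψd x), real_inner_comm (Ψ x) a, ← real_inner_self_eq_norm_sq]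
    simp only [Pi.add_apply, Pi.mul_apply]
    ring
  have hcont1 : Continuous fun x => ‖Ψ x‖ ^ 2 / 2 := by fun_prop
  have hcont2 : Continuous fun x => (1 + x) * inner ℝ (B (Ψ x)) (Ψ x) := by
    simp_rw [hBΨ]; fun_prop
  have hcont3 : Continuous fun x => q.eval x * κ x := q.continuous.mul hκc
  have hFTC := intervalIntegral.integral_eq_sub_of_hasDerivAt (a := -1) (b := 1)
    (fun x _ => hderiv x) (((hcont1.add hcont2).add hcont3).intervalIntegrable _ _)
  have hcont12 : Continuous fun x => ‖Ψ x‖ ^ 2 / 2 + (1 + x) * inner ℝ (B (Ψ x)) (Ψ x) :=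
    hcont1.add hcont2
  rw [intervalIntegral.integral_add (hcont12.intervalIntegrable _ _)
      (hcont3.intervalIntegrable _ _),
    intervalIntegral.integral_add (hcont1.intervalIntegrable _ _)
      (hcont2.intervalIntegrable _ _), integral_mul_legK_self_eq_zero hdeg,
    intervalIntegral.integral_div] at hFTC
  have hpos : 0 ≤ ∫ x in (-1 : ℝ)..1, (1 + x) * inner ℝ (B (Ψ x)) (Ψ x) :=
    intervalIntegral.integral_nonneg (by norm_num) fun x hx =>
      mul_nonneg (by linarith [hx.1]) (hB _)
  -- The boundary term at 1 falls short of `‖Φ(1)‖²` by a square, which is dropped.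
  have hend : ‖legSum r (r + 1) c 1‖ ^ 2 =
      inner ℝ (Ψ 1) (Ψ 1) + 2 * (κ 1 * inner ℝ (Ψ 1) a) + κ 1 ^ 2 * ‖a‖ ^ 2 := by
    rw [legSum_succ, norm_add_sq_real, real_inner_smul_right, norm_smul, mul_pow,
      real_inner_self_eq_norm_sq, Real.norm_eq_abs, sq_abs]
  have := mul_nonneg (sq_nonneg (κ 1)) (sq_nonneg ‖a‖)
  rw [hend]
  linarith

/-- The discrete adjoint solution is stable. -/
lemma norm_legSum_neg_one_le {r : ℕ} (hr : 1 ≤ r) {B : E →ₗ[ℝ] E}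
    (hB : ∀ x, 0 ≤ inner ℝ (B x) x) (G : E) :
    ‖legSum r (r + 1) (krylov B G) (-1)‖ ≤ ‖legSum r (r + 1) (krylov B G) 1‖ := by
  set c := krylov B G
  set Ψ := legSum r r c
  set Φ := legSum r (r + 1) c
  set q := legPair r r (fun i => B (c i)) (c r)
  have hBΨ : ∀ x, B (Ψ x) = legSum r r (fun i => B (c i)) x := fun x => by
    simp [Ψ, legSum, map_sum]
  have hBc : Continuous fun x => B (Ψ x) := by
    simp_rw [hBΨ]; exact continuous_legSum _ _ _
  have hΨc : Continuous Ψ := continuous_legSum _ _ _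
  -- With `Φ = Ψ + K_r c_r` and `Φ' = BΨ`, the energy derivative is `(BΨ, Ψ) ≥ 0` plus a term
  -- orthogonal to `K_r`'s test space, so `‖Φ‖` is no smaller at 1 than at `-1`.
  have hderiv : ∀ x, HasDerivAt (fun x => inner ℝ (Φ x) (Φ x) / 2)
      (inner ℝ (B (Ψ x)) (Ψ x) + q.eval x * (legK r r).eval x) x := by
    intro x
    have hΦ : HasDerivAt Φ (B (Ψ x)) x := by
      rw [← legSumDeriv_krylov]; exact hasDerivAt_legSum _ _ _ _
    refine ((hΦ.inner ℝ hΦ).div_const 2).congr_deriv ?_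
    rw [real_inner_comm (B (Ψ x)) (Φ x)]
    simp only [Φ, legSum_succ, q, eval_legPair, ← hBΨ, inner_add_right, real_inner_smul_right, Ψ]
    ring
  have hcont1 : Continuous fun x => inner ℝ (B (Ψ x)) (Ψ x) := hBc.inner hΨc
  have hcont2 : Continuous fun x => q.eval x * (legK r r).eval x :=
    q.continuous.mul (legK r r).continuous
  have hFTC := intervalIntegral.integral_eq_sub_of_hasDerivAt (a := -1) (b := 1)
    (fun x _ => hderiv x) ((hcont1.add hcont2).intervalIntegrable _ _)
  rw [intervalIntegral.integral_add (hcont1.intervalIntegrable _ _)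
      (hcont2.intervalIntegrable _ _),
    integral_mul_legK_self_eq_zero (natDegree_legPair_lt hr (by omega) _ _),
    real_inner_self_eq_norm_sq, real_inner_self_eq_norm_sq] at hFTC
  have hpos : 0 ≤ ∫ x in (-1 : ℝ)..1, inner ℝ (B (Ψ x)) (Ψ x) :=
    intervalIntegral.integral_nonneg (by norm_num) fun x _ => hB _
  exact le_of_sq_le_sq (by linarith) (norm_nonneg _)

/-- Bound of one Krylov vector by later ones and the nodal value of the discrete adjoint. -/
lemma norm_krylov_le {r j : ℕ} (hj : j < r) {B : E →ₗ[ℝ] E}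
    (hB : ∀ x, 0 ≤ inner ℝ (B x) x) (G : E) :
    ‖krylov B G j‖ ≤
      √((2 * j).factorial * (j + 1)) * ‖legSum r (r + 1) (krylov B G) 1‖ +
        ∑ i ∈ Finset.range r with j < i ∧ Even (i - j), ‖krylov B G i‖ := by
  set c := krylov B G
  set φ := ‖legSum r (r + 1) c 1‖
  set e := c j
  set S := ∑ i ∈ Finset.range r with j < i ∧ Even (i - j), ‖c i‖
  set ψ := legPair r r c e
  set J := ∫ x in (-1 : ℝ)..1, ψ.eval x * (derivative^[j] (legW j)).eval x
  have hI := legI_pos j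
  -- Pairing `(Ψ, c_j)` with the Legendre polynomial of degree `j` and integrating by parts `j`
  -- times leaves the weight `(1 - x²)^j`; the two signs `(-1)^j` cancel.
  have hexp : J = ∑ i ∈ Finset.range r, inner ℝ (c i) e *
      ∫ x in (-1 : ℝ)..1, (derivative^[j] (legK r i)).eval x * (1 - x ^ 2) ^ j := by
    have h1 : J = ∫ x in (-1 : ℝ)..1, (derivative^[j] ψ).eval x * (1 - x ^ 2) ^ j := by
      rw [show J = _ from integral_mul_iterate_derivative_legW le_rfl ψ,
        ← intervalIntegral.integral_const_mul]
      refine intervalIntegral.integral_congr fun x _ => ?_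
      simp only [Nat.sub_self, Function.iterate_zero, id_eq, eval_legW]
      have : ((-1 : ℝ) ^ j) * (-1) ^ j = 1 := by rw [← mul_pow]; simp
      linear_combination (derivative^[j] ψ).eval x * (1 - x ^ 2) ^ j * this
    rw [h1]
    simp_rw [← intervalIntegral.integral_const_mul]
    rw [← intervalIntegral.integral_finsetSum]
    · refine intervalIntegral.integral_congr fun x _ => ?_
      simp only [ψ, legPair, iterate_derivative_sum, iterate_derivative_C_mul, eval_finsetSum,
        eval_mul, eval_C, Finset.sum_mul, mul_assoc]
    · intro i _
      exact (continuous_const.mul ((derivative^[j] (legK r i)).continuous.mul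
        (by fun_prop))).intervalIntegrable _ _
  -- As `K_i` becomes `K_{i-j}`, indices below `j` vanish, `i = j` gives the diagonal term, and odd
  -- `i - j` drops out by parity.
  have hterm : ∀ i ∈ Finset.range r, (if i = j then legI j * ‖e‖ ^ 2 else 0) -
      (if j < i ∧ Even (i - j) then ‖c i‖ * ‖e‖ * legI j else 0) ≤ inner ℝ (c i) e *
      ∫ x in (-1 : ℝ)..1, (derivative^[j] (legK r i)).eval x * (1 - x ^ 2) ^ j := by
    intro i hi
    rw [Finset.mem_range] at hi
    rcases lt_trichotomy i j with h | h | h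
    · rw [iterate_derivative_legK_eq_zero h (by omega)]
      simp [h.ne, h.not_gt]
    · subst h
      rw [iterate_derivative_legK le_rfl (by omega), Nat.sub_self, legK_zero]
      simp only [if_true, lt_self_iff_false, false_and, if_false, eval_one, one_mul, sub_zero]
      rw [real_inner_self_eq_norm_sq, mul_comm, legI]
    · rw [iterate_derivative_legK h.le (by omega)]
      rcases Nat.even_or_odd (i - j) with hev | hodd
      · obtain ⟨k, hk⟩ := hev
        rw [← two_mul] at hk
        simp only [h.ne', if_false, h, hk, even_two_mul, and_self, if_true, zero_sub]
        have h1 := integral_even_legK_mul_weight_le (r := r) (j := j) (k := k) (by omega)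
        have h2 := abs_real_inner_le_norm (c i) e
        refine neg_le_of_abs_le ?_
        rw [abs_mul]
        gcongr
      · rw [integral_odd_legK_mul_weight (by omega) hodd]
        simp [h.ne', Nat.not_even_iff_odd.2 hodd]
  have hlow : legI j * ‖e‖ ^ 2 - S * ‖e‖ * legI j ≤ J := by
    rw [hexp]
    refine le_trans (le_of_eq ?_) (Finset.sum_le_sum hterm)
    rw [Finset.sum_sub_distrib, Finset.sum_ite_eq' (Finset.range r) j, if_pos
      (Finset.mem_range.2 hj), ← Finset.sum_filter, ← Finset.sum_mul, ← Finset.sum_mul]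
  -- Cauchy–Schwarz, with the energy bound for `Ψ` and the exact `L²` norm of the Legendre
  -- polynomial.
  have hup : J ^ 2 ≤ (2 * φ ^ 2 * ‖e‖ ^ 2) * ((2 * j).factorial * legI j) := by
    have h1 := sq_intervalIntegral_mul_le (a := -1) (b := 1) (by norm_num) ψ.continuous
      (derivative^[j] (legW j)).continuous
    rw [integral_iterate_derivative_legW_sq] at h1
    refine h1.trans (mul_le_mul_of_nonneg_right ?_ (by positivity))
    calc ∫ x in (-1 : ℝ)..1, ψ.eval x ^ 2
        ≤ ∫ x in (-1 : ℝ)..1, ‖legSum r r c x‖ ^ 2 * ‖e‖ ^ 2 := by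
          refine intervalIntegral.integral_mono_on (by norm_num)
            ((ψ.continuous.pow 2).intervalIntegrable _ _)
            ((((continuous_legSum r r c).norm.pow 2).mul
              continuous_const).intervalIntegrable _ _) fun x _ => ?_
          rw [eval_legPair, ← mul_pow, ← sq_abs]
          gcongr
          exact abs_real_inner_le_norm _ _
      _ ≤ 2 * φ ^ 2 * ‖e‖ ^ 2 := by
          rw [intervalIntegral.integral_mul_const]
          gcongr
          exact integral_norm_sq_legSum_le (by omega) hB G
  rcases (norm_nonneg e).eq_or_lt with he | he
  · rw [← he]
    exact add_nonneg (by positivity) (Finset.sum_nonneg fun _ _ => norm_nonneg _)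
  have hJ : J ≤ legI j * ‖e‖ * (√((2 * j).factorial * (j + 1)) * φ) := by
    refine abs_le_of_sq_le_sq' ?_ (by positivity) |>.2
    refine hup.trans ?_
    rw [mul_pow, mul_pow, mul_pow, Real.sq_sqrt (by positivity)]
    have h2 : 2 ≤ legI j * (j + 1) := by
      have := two_div_le_legI j
      rwa [div_le_iff₀ (by positivity)] at this
    calc 2 * φ ^ 2 * ‖e‖ ^ 2 * ((2 * j).factorial * legI j)
        = 2 * (φ ^ 2 * ‖e‖ ^ 2 * ((2 * j).factorial * legI j)) := by ring
      _ ≤ (legI j * (j + 1)) * (φ ^ 2 * ‖e‖ ^ 2 * ((2 * j).factorial * legI j)) := by gcongr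
      _ = _ := by ring
  have hfin : legI j * ‖e‖ * ‖e‖ ≤
      legI j * ‖e‖ * (√((2 * j).factorial * (j + 1)) * φ + S) := by nlinarith
  exact le_of_mul_le_mul_left hfin (by positivity)

/-- A discrete Gronwall inequality with steps of length two. -/
lemma discrete_gronwall_two {r : ℕ} {g : ℕ → ℝ} {c : ℝ} (hc : 0 ≤ c)
    (h : ∀ j < r, g j ≤ c + ∑ i ∈ Finset.range r with j < i ∧ Even (i - j), g i) :
    ∀ j < r, g j ≤ 5 * c * (3 / 2) ^ r * (2 / 3) ^ j := by
  have hgeom : ∀ n : ℕ, ∑ k ∈ Finset.range n, (4 / 9 : ℝ) ^ k ≤ 9 / 5 := by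
    intro n
    have : ∑ k ∈ Finset.range n, (4 / 9 : ℝ) ^ k = 9 / 5 * (1 - (4 / 9) ^ n) := by
      rw [geom_sum_eq (by norm_num)]; ring
    rw [this]
    have : (0 : ℝ) < (4 / 9) ^ n := by positivity
    linarith
  -- The indices are `j+2, j+4, …` and `Σ_{k ≥ 1} (4/9)^k = 4/5`. The prefactor 5 in the claim then
  -- reproduces itself, as `1 + 4 = 5`.
  have hsum : ∀ j, ∑ i ∈ Finset.range r with j < i ∧ Even (i - j), (2 / 3 : ℝ) ^ i ≤
      4 / 5 * (2 / 3) ^ j := by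
    intro j
    have hsub : (Finset.range r).filter (fun i => j < i ∧ Even (i - j)) ⊆
        (Finset.range r).image fun k => j + 2 + 2 * k := by
      intro i hi
      rw [Finset.mem_filter, Finset.mem_range] at hi
      obtain ⟨hir, hji, m, hm⟩ := hi
      exact Finset.mem_image.2 ⟨m - 1, Finset.mem_range.2 (by omega), by omega⟩
    refine (Finset.sum_le_sum_of_subset_of_nonneg hsub fun _ _ _ => by positivity).trans ?_
    rw [Finset.sum_image fun a _ b _ hab => by simpa using hab]
    have : ∀ k, (2 / 3 : ℝ) ^ (j + 2 + 2 * k) = 4 / 9 * (2 / 3) ^ j * (4 / 9) ^ k := by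
      intro k
      rw [pow_add, pow_add, pow_mul]
      norm_num
      ring
    simp_rw [this]
    rw [← Finset.mul_sum]
    have h1 : (0 : ℝ) ≤ (2 / 3) ^ j := by positivity
    nlinarith [hgeom r]
  have hpow : ∀ j ≤ r, (1 : ℝ) ≤ (3 / 2) ^ r * (2 / 3) ^ j := by
    intro j hj
    have h1 : (3 / 2 : ℝ) ^ j * (2 / 3) ^ j = 1 := by rw [← mul_pow]; norm_num
    rw [← h1]
    gcongr
    norm_num
  have key : ∀ m j, j < r → r - j = m → g j ≤ 5 * c * (3 / 2) ^ r * (2 / 3) ^ j := by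
    intro m
    induction m using Nat.strong_induction_on with
    | _ m ih =>
      intro j hj hm
      have h1 : ∑ i ∈ Finset.range r with j < i ∧ Even (i - j), g i ≤
          ∑ i ∈ Finset.range r with j < i ∧ Even (i - j),
            5 * c * (3 / 2) ^ r * (2 / 3 : ℝ) ^ i := by
        refine Finset.sum_le_sum fun i hi => ?_
        rw [Finset.mem_filter, Finset.mem_range] at hi
        exact ih (r - i) (by omega) i hi.1 rfl
      rw [← Finset.mul_sum] at h1
      have h2 := mul_le_mul_of_nonneg_left (hsum j)
        (show 0 ≤ 5 * c * (3 / 2 : ℝ) ^ r by positivity)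
      have h3 := mul_le_mul_of_nonneg_left (hpow j hj.le) hc
      have h4 := h j hj
      linarith
  exact fun j hj => key _ j hj rfl

/-- The stability constant of the discrete adjoint problem. -/
noncomputable def adjConst (r : ℕ) : ℝ := 5 * (3 / 2) ^ r * √((2 * r - 2).factorial * r)

/-- Read at `j = 0`, the downward recursion for the Krylov vectors bounds `G` itself. The constant
does not involve `B`, hence neither the matrix nor the step size. -/
lemma norm_le_adjConst_mul {r : ℕ} (hr : 1 ≤ r) {B : E →ₗ[ℝ] E}
    (hB : ∀ x, 0 ≤ inner ℝ (B x) x) (G : E) :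
    ‖G‖ ≤ adjConst r * ‖legSum r (r + 1) (krylov B G) 1‖ := by
  -- The factor `(2j)! (j+1)` is replaced by its largest value, at `j = r - 1`.
  have h := discrete_gronwall_two (r := r) (g := fun j => ‖krylov B G j‖)
    (c := √((2 * r - 2).factorial * r) * ‖legSum r (r + 1) (krylov B G) 1‖) (by positivity)
    (fun j hj => (norm_krylov_le hj hB G).trans ?_) 0 (by omega)
  · rw [pow_zero, mul_one] at h
    refine h.trans (le_of_eq ?_)
    rw [adjConst]
    ring
  · gcongr
    · omega
    · exact_mod_cast hj

/-- The discrete adjoint problem is solvable for every nodal value. -/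
lemma exists_legSum_one_eq [FiniteDimensional ℝ E] {r : ℕ} (hr : 1 ≤ r) {B : E →ₗ[ℝ] E}
    (hB : ∀ x, 0 ≤ inner ℝ (B x) x) (φ : E) :
    ∃ G, legSum r (r + 1) (krylov B G) 1 = φ := by
  let S : E →ₗ[ℝ] E := ∑ i ∈ Finset.range (r + 1), (legK r i).eval 1 • B ^ i
  have hS : ∀ G, S G = legSum r (r + 1) (krylov B G) 1 := fun G => by
    simp [S, legSum, krylov, LinearMap.sum_apply]
  -- Stability gives uniqueness, and in finite dimension uniqueness gives existence.
  have hinj : Function.Injective S := by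
    rw [injective_iff_map_eq_zero]
    intro G hG
    have := norm_le_adjConst_mul hr hB G
    rw [← hS, hG, norm_zero, mul_zero] at this
    exact norm_le_zero_iff.1 this
  obtain ⟨G, hG⟩ := LinearMap.surjective_of_injective hinj φ
  exact ⟨G, (hS G).symm.trans hG⟩

end DiscreteAdjoint

/-! ### The Legendre chain transported to a general interval. -/

section LocalPolynomials

open Polynomial

/-- The polynomials `legK` transported to the interval `[a, b]`, again with leading coefficients
`1 / l!`. -/
noncomputable def locK (a b : ℝ) (r l : ℕ) : ℝ[X] :=
  C (((b - a) / 2) ^ l) * (legK r l).comp (C ((b - a) / 2)⁻¹ * (X - C ((a + b) / 2)))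

variable {a b : ℝ}

lemma eval_locK (r l : ℕ) (x : ℝ) : (locK a b r l).eval x =
    ((b - a) / 2) ^ l * (legK r l).eval (((b - a) / 2)⁻¹ * (x - (a + b) / 2)) := by
  simp [locK, eval_comp]

lemma locK_zero (r : ℕ) : locK a b r 0 = 1 := by
  simp [locK, legK_zero]

lemma natDegree_locK_le {r l : ℕ} (h : l ≤ 2 * r) : (locK a b r l).natDegree ≤ l := by
  refine (natDegree_C_mul_le _ _).trans ?_
  have h1 : (C ((b - a) / 2)⁻¹ * (X - C ((a + b) / 2)) : ℝ[X]).natDegree ≤ 1 :=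
    (natDegree_C_mul_le _ _).trans (natDegree_X_sub_C_le _)
  calc _ ≤ (legK r l).natDegree * _ := natDegree_comp_le
    _ ≤ l * 1 := Nat.mul_le_mul (natDegree_legK_le h) h1
    _ = l := mul_one l

lemma derivative_locK_succ (hab : a < b) {r l : ℕ} (h : l + 1 ≤ 2 * r) :
    derivative (locK a b r (l + 1)) = locK a b r l := by
  have hne : (b - a) / 2 ≠ 0 := by linarith
  rw [locK, derivative_C_mul, derivative_comp, derivative_legK_succ h, locK, derivative_C_mul,
    derivative_sub, derivative_X, derivative_C, sub_zero, mul_one, pow_succ, ← mul_assoc, ← C_mul,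
    mul_assoc, mul_inv_cancel₀ hne, mul_one]

lemma eval_locK_right (hab : a < b) (r l : ℕ) :
    (locK a b r l).eval b = ((b - a) / 2) ^ l * (legK r l).eval 1 := by
  rw [eval_locK]
  have : b - a ≠ 0 := by linarith
  congr 2
  field_simp
  ring

lemma eval_locK_left (hab : a < b) (r l : ℕ) :
    (locK a b r l).eval a = ((b - a) / 2) ^ l * (legK r l).eval (-1) := by
  rw [eval_locK]
  have : b - a ≠ 0 := by linarith
  congr 2
  field_simp
  ring

lemma eval_locK_endpoints (hab : a < b) {r l : ℕ} (hrl : r < l) (hl : l ≤ 2 * r) :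
    (locK a b r l).eval a = 0 ∧ (locK a b r l).eval b = 0 := by
  rw [eval_locK_left hab, eval_locK_right hab, eval_legK_eq_zero hrl hl (by norm_num),
    eval_legK_eq_zero hrl hl (by norm_num)]
  simp

lemma integral_eq_integral_reference (hab : a < b) (f : ℝ → ℝ) :
    ∫ x in a..b, f x =
      (b - a) / 2 * ∫ x in (-1 : ℝ)..1, f ((b - a) / 2 * x + (a + b) / 2) := by
  have hne : (b - a) / 2 ≠ 0 := by linarith
  rw [intervalIntegral.integral_comp_mul_add f hne, smul_eq_mul, mul_inv_cancel_left₀ hne]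
  congr 1 <;> ring

lemma eval_locK_reference (hab : a < b) (r l : ℕ) (x : ℝ) :
    (locK a b r l).eval ((b - a) / 2 * x + (a + b) / 2) =
      ((b - a) / 2) ^ l * (legK r l).eval x := by
  have hne : (b - a) / 2 ≠ 0 := by linarith
  rw [eval_locK, add_sub_cancel_right, inv_mul_cancel_left₀ hne]

lemma integral_mul_locK_self_eq_zero (hab : a < b) {r : ℕ} {p : ℝ[X]} (hp : p.natDegree < r) :
    ∫ x in a..b, p.eval x * (locK a b r r).eval x = 0 := by
  rw [integral_eq_integral_reference hab]
  simp_rw [eval_locK_reference hab]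
  have h := integral_mul_legK_self_eq_zero (r := r)
    (p := p.comp (C ((b - a) / 2) * X + C ((a + b) / 2))) ?_
  · simp only [eval_comp, eval_add, eval_mul, eval_C, eval_X] at h
    rw [show (fun x => p.eval ((b - a) / 2 * x + (a + b) / 2) *
        (((b - a) / 2) ^ r * (legK r r).eval x)) = fun x => ((b - a) / 2) ^ r *
        (p.eval ((b - a) / 2 * x + (a + b) / 2) * (legK r r).eval x) by ext; ring,
      intervalIntegral.integral_const_mul, h, mul_zero, mul_zero]
  · refine lt_of_le_of_lt (natDegree_comp_le.trans ?_) hp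
    exact (Nat.mul_le_mul_left _ natDegree_linear_le).trans (mul_one _).le

lemma integral_locK_sq_le (hab : a < b) {r m : ℕ} (hm : m ≤ r) :
    ∫ x in a..b, (locK a b r (r + m)).eval x ^ 2 ≤
      ((b - a) / 2) ^ (2 * (r + m) + 1) * (4 ^ m * (2 / (2 * r).factorial)) := by
  have hpos : 0 < (b - a) / 2 := by linarith
  rw [integral_eq_integral_reference hab]
  simp_rw [eval_locK_reference hab, mul_pow]
  rw [intervalIntegral.integral_const_mul, ← mul_assoc,
    show (b - a) / 2 * (((b - a) / 2) ^ (r + m)) ^ 2 = ((b - a) / 2) ^ (2 * (r + m) + 1) by ring]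
  gcongr
  exact integral_legK_sq_le hm

end LocalPolynomials

/-! ### Integration by parts for absolutely continuous functions. -/

section AbsoluteContinuity

lemma contDiff_eval (k : Polynomial ℝ) {n : ℕ∞ω} : ContDiff ℝ n fun x => k.eval x := by
  simpa only [Polynomial.coe_aeval_eq_eval] using k.contDiff_aeval (𝕜 := ℝ) (n := n)

variable {E : Type*} [NormedAddCommGroup E] [InnerProductSpace ℝ E] {a b : ℝ}

lemma AbsolutelyContinuousOnInterval.inner_const {u : ℝ → E}
    (hu : AbsolutelyContinuousOnInterval u a b) (c : E) :
    AbsolutelyContinuousOnInterval (fun x => inner ℝ (u x) c) a b := by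
  refine squeeze_zero (fun t => Finset.sum_nonneg fun i _ => dist_nonneg) (fun t => ?_)
    (by simpa using Filter.Tendsto.mul_const ‖c‖ hu)
  rw [Finset.sum_mul]
  refine Finset.sum_le_sum fun i _ => ?_
  rw [Real.dist_eq, dist_eq_norm, ← inner_sub_left]
  exact abs_real_inner_le_norm _ _

lemma AbsolutelyContinuousOnInterval.integral_eq_sub_of_ae_hasDerivAt {f f' : ℝ → ℝ}
    (hab : a ≤ b) (hf : AbsolutelyContinuousOnInterval f a b)
    (hf' : ∀ᵐ x ∂(volume.restrict (Ioo a b)), HasDerivAt f (f' x) x) :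
    IntervalIntegrable f' volume a b ∧ ∫ x in a..b, f' x = f b - f a := by
  have h1 : deriv f =ᵐ[volume.restrict (uIoc a b)] f' := by
    rw [uIoc_of_le hab, restrict_Ioo_eq_restrict_Ioc.symm]
    exact hf'.mono fun x hx => hx.deriv
  refine ⟨hf.intervalIntegrable_deriv.congr_ae h1, ?_⟩
  rw [← hf.integral_deriv_eq_sub]
  refine (intervalIntegral.integral_congr_ae_restrict h1).symm

/-- Integration by parts of an absolutely continuous function against a `C¹` function. -/
lemma AbsolutelyContinuousOnInterval.integral_mul_contDiff {f f' k k' : ℝ → ℝ}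
    (hab : a ≤ b) (hf : AbsolutelyContinuousOnInterval f a b)
    (hf' : ∀ᵐ x ∂(volume.restrict (Ioo a b)), HasDerivAt f (f' x) x)
    (hk : ContDiff ℝ 1 k) (hk' : ∀ x, HasDerivAt k (k' x) x) :
    ∫ x in a..b, f' x * k x = f b * k b - f a * k a - ∫ x in a..b, f x * k' x := by
  have hkAC : AbsolutelyContinuousOnInterval k a b :=
    hk.contDiffOn.absolutelyContinuousOnInterval
  have hk'c : Continuous k' := by
    rw [← funext fun x => (hk' x).deriv]
    exact hk.continuous_deriv le_rfl
  have h := (hf.mul hkAC).integral_eq_sub_of_ae_hasDerivAt (f' := fun x =>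
    f' x * k x + f x * k' x) hab (hf'.mono fun x hx => hx.mul (hk' x))
  have hi := (hf.integral_eq_sub_of_ae_hasDerivAt hab hf').1
  have hi2 : IntervalIntegrable (fun x => f x * k' x) volume a b :=
    (hf.continuousOn.mul hk'c.continuousOn).intervalIntegrable
  rw [intervalIntegral.integral_add (hi.mul_continuousOn hk.continuous.continuousOn) hi2] at h
  have := h.2
  simp only [Pi.mul_apply] at this
  linarith

open Polynomial in
lemma AbsolutelyContinuousOnInterval.integral_mul_eval {f f' : ℝ → ℝ}
    (hab : a ≤ b) (hf : AbsolutelyContinuousOnInterval f a b)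
    (hf' : ∀ᵐ x ∂(volume.restrict (Ioo a b)), HasDerivAt f (f' x) x) (k : ℝ[X]) :
    ∫ x in a..b, f' x * k.eval x =
      f b * k.eval b - f a * k.eval a - ∫ x in a..b, f x * (derivative k).eval x :=
  hf.integral_mul_contDiff hab hf' (contDiff_eval k) k.hasDerivAt

end AbsoluteContinuity

/-! ### Vector-valued polynomials and their scalar components. -/

section VectorPolynomials

open Polynomial

variable {M : ℕ}

lemma isVecPoly_eval_smul {m : ℕ} {k : ℝ[X]} (hk : k.natDegree ≤ m)
    (c : EuclideanSpace ℝ (Fin M)) : IsVecPoly m fun x => k.eval x • c := by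
  refine ⟨fun j => k.coeff j • c, fun x => ?_⟩
  simp only
  rw [eval_eq_sum_range' (Nat.lt_succ_of_le hk), Finset.sum_smul]
  exact Finset.sum_congr rfl fun j _ => by rw [smul_smul, mul_comm]

lemma IsVecPoly.exists_inner_eq {m : ℕ} {p : ℝ → EuclideanSpace ℝ (Fin M)} (hp : IsVecPoly m p)
    (c : EuclideanSpace ℝ (Fin M)) :
    ∃ k : ℝ[X], k.natDegree ≤ m ∧ ∀ x, inner ℝ (p x) c = k.eval x := by
  obtain ⟨d, hd⟩ := hp
  refine ⟨∑ j ∈ Finset.range (m + 1), C (inner ℝ (d j) c) * X ^ j, ?_, fun x => ?_⟩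
  · refine natDegree_sum_le_of_forall_le _ _ fun j hj => ?_
    rw [Finset.mem_range] at hj
    exact (natDegree_C_mul_X_pow_le _ _).trans (by omega)
  · rw [hd, sum_inner, eval_finsetSum]
    exact Finset.sum_congr rfl fun j _ => by
      rw [real_inner_smul_left, eval_mul, eval_C, eval_pow, eval_X, mul_comm]

lemma IsVecPoly.continuous {m : ℕ} {p : ℝ → EuclideanSpace ℝ (Fin M)} (hp : IsVecPoly m p) :
    Continuous p := by
  obtain ⟨d, hd⟩ := hp
  rw [funext hd]
  fun_prop

end VectorPolynomials

/-! ### The error representation on one time step. -/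

section StepIdentity

open Polynomial

variable {M r : ℕ} {a b : ℝ}

lemma IsLocalProj.integral_inner_mul_eval {m : ℕ} {v p : ℝ → EuclideanSpace ℝ (Fin M)}
    (h : IsLocalProj a b m v p) (hab : a ≤ b) {k : ℝ[X]} (hk : k.natDegree ≤ m)
    (c : EuclideanSpace ℝ (Fin M)) :
    ∫ x in a..b, inner ℝ (p x) c * k.eval x = ∫ x in a..b, inner ℝ (v x) c * k.eval x := by
  have := h.2 _ (isVecPoly_eval_smul hk c)
  rw [intervalIntegral.integral_of_le hab, intervalIntegral.integral_of_le hab,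
    integral_Ioc_eq_integral_Ioo, integral_Ioc_eq_integral_Ioo]
  simpa only [real_inner_smul_right, mul_comm] using this

/-- The error representation of the Galerkin method on one interval, for a sequence `c` generated
by minus the adjoint of the operator of the equation. -/
lemma galerkin_step_identity (hab : a < b) (hr : 1 ≤ r)
    (A : EuclideanSpace ℝ (Fin M) →ₗ[ℝ] EuclideanSpace ℝ (Fin M))
    {R Y Z p q : ℝ → EuclideanSpace ℝ (Fin M)} (hR : IntegrableOn R (Ioo a b))
    (hY : AbsolutelyContinuousOnInterval Y a b)
    (hY' : ∀ᵐ x ∂(volume.restrict (Ioo a b)), HasDerivAt Y (A (Y x) + R x) x)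
    (hZ : ContinuousOn Z (Icc a b)) (hZr : ∃ P, IsVecPoly r P ∧ EqOn Z P (Ioo a b))
    (hp : IsLocalProj a b (r - 1) Z p) (hq : IsLocalProj a b (r - 1) R q)
    (hZ' : ∀ x ∈ Ioo a b, HasDerivAt Z (A (p x) + q x) x)
    {c : ℕ → EuclideanSpace ℝ (Fin M)} (hc : ∀ i, c (i + 1) = -LinearMap.adjoint A (c i)) :
    ∑ i ∈ Finset.range (r + 1), (inner ℝ (Y b - Z b) (c i) * (locK a b r i).eval b -
      inner ℝ (Y a - Z a) (c i) * (locK a b r i).eval a) =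
      ∫ x in a..b, inner ℝ (A (Y x) + R x) (c r) * (locK a b r r).eval x := by
  obtain ⟨P, hPr, hZP⟩ := hZr
  have hPc := hPr.continuous
  have hZPcc : EqOn Z P (Icc a b) :=
    hZP.of_subset_closure hZ hPc.continuousOn Ioo_subset_Icc_self (closure_Ioo hab.ne).ge
  have hYc : ContinuousOn Y (uIcc a b) := hY.continuousOn
  have hadj : ∀ (v d : EuclideanSpace ℝ (Fin M)),
      inner ℝ (A v) d = inner ℝ v (LinearMap.adjoint A d) := fun v d =>
    (LinearMap.adjoint_inner_right A v d).symm
  have hRi : ∀ (d : EuclideanSpace ℝ (Fin M)) (k : ℝ[X]),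
      IntervalIntegrable (fun x => inner ℝ (R x) d * k.eval x) volume a b := by
    intro d k
    have h1 : IntegrableOn (fun x => inner ℝ (R x) d) (Ioo a b) := hR.inner_const d
    have h2 : IntervalIntegrable (fun x => inner ℝ (R x) d) volume a b := by
      rwa [intervalIntegrable_iff_integrableOn_Ioo_of_le hab.le]
    exact h2.mul_continuousOn k.continuous.continuousOn
  have hci : ∀ (v : ℝ → EuclideanSpace ℝ (Fin M)) (d : EuclideanSpace ℝ (Fin M)) (k : ℝ[X]),
      ContinuousOn v (uIcc a b) →
      IntervalIntegrable (fun x => inner ℝ (v x) d * k.eval x) volume a b := fun v d k hv =>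
    ((hv.inner continuousOn_const).mul k.continuous.continuousOn).intervalIntegrable
  -- the error and its derivative, tested with a fixed vector
  have hparts : ∀ (d : EuclideanSpace ℝ (Fin M)) (k : ℝ[X]),
      inner ℝ (Y b - Z b) d * k.eval b - inner ℝ (Y a - Z a) d * k.eval a =
      (∫ x in a..b, inner ℝ (A (Y x) + R x - (A (p x) + q x)) d * k.eval x) +
        ∫ x in a..b, inner ℝ (Y x - P x) d * (derivative k).eval x := by
    intro d k
    obtain ⟨kP, -, hkP⟩ := hPr.exists_inner_eq d
    have hAC : AbsolutelyContinuousOnInterval (fun x => inner ℝ (Y x - P x) d) a b := by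
      simp_rw [inner_sub_left, hkP]
      exact (hY.inner_const d).fun_sub (contDiff_eval kP).contDiffOn.absolutelyContinuousOnInterval
    have hder : ∀ᵐ x ∂(volume.restrict (Ioo a b)), HasDerivAt (fun x => inner ℝ (Y x - P x) d)
        (inner ℝ (A (Y x) + R x - (A (p x) + q x)) d) x := by
      filter_upwards [hY', ae_restrict_mem measurableSet_Ioo] with x hx hxI
      have hP' : HasDerivAt P (A (p x) + q x) x :=
        (hZ' x hxI).congr_of_eventuallyEq
          ((hZP.eventuallyEq_of_mem (isOpen_Ioo.mem_nhds hxI)).symm)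
      simpa using (hx.sub hP').inner ℝ (hasDerivAt_const x d)
    rw [hAC.integral_mul_eval hab.le hder k, hZPcc (left_mem_Icc.2 hab.le),
      hZPcc (right_mem_Icc.2 hab.le)]
    ring
  have hprojZ : ∀ (d : EuclideanSpace ℝ (Fin M)) {k : ℝ[X]}, k.natDegree ≤ r - 1 →
      ∫ x in a..b, inner ℝ (p x) d * k.eval x = ∫ x in a..b, inner ℝ (P x) d * k.eval x := by
    intro d k hk
    rw [hp.integral_inner_mul_eval hab.le hk d]
    refine intervalIntegral.integral_congr fun x hx => ?_
    rw [uIcc_of_le hab.le] at hx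
    simp only [hZPcc hx]
  have hpc := hp.1.continuous.continuousOn (s := uIcc a b)
  have hqc := hq.1.continuous.continuousOn (s := uIcc a b)
  -- For `i < r` the factor `K_i` lies in `P^{r-1}`, so both projections may be removed; `R` cancels
  -- and `A` passes to `c_i`.
  have hlow : ∀ i < r, ∫ x in a..b,
      inner ℝ (A (Y x) + R x - (A (p x) + q x)) (c i) * (locK a b r i).eval x =
      -∫ x in a..b, inner ℝ (Y x - P x) (c (i + 1)) * (locK a b r i).eval x := by
    intro i hi
    have hdeg : (locK a b r i).natDegree ≤ r - 1 := (natDegree_locK_le (by omega)).trans (by omega)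
    set k := locK a b r i
    set d := LinearMap.adjoint A (c i)
    have h1 : ∀ x, inner ℝ (A (Y x) + R x - (A (p x) + q x)) (c i) * k.eval x =
        inner ℝ (Y x) d * k.eval x + inner ℝ (R x) (c i) * k.eval x -
          (inner ℝ (p x) d * k.eval x + inner ℝ (q x) (c i) * k.eval x) := fun x => by
      rw [inner_sub_left, inner_add_left, inner_add_left, hadj, hadj]; ring
    have h2 : ∀ x, inner ℝ (Y x - P x) (c (i + 1)) * k.eval x =
        -(inner ℝ (Y x) d * k.eval x - inner ℝ (P x) d * k.eval x) := fun x => by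
      rw [hc, inner_neg_right, inner_sub_left]; ring
    simp_rw [h1, h2]
    rw [intervalIntegral.integral_sub ((hci _ _ _ hYc).add (hRi _ _))
        ((hci _ _ _ hpc).add (hci _ _ _ hqc)),
      intervalIntegral.integral_add (hci _ _ _ hYc) (hRi _ _),
      intervalIntegral.integral_add (hci _ _ _ hpc) (hci _ _ _ hqc),
      intervalIntegral.integral_neg,
      intervalIntegral.integral_sub (hci _ _ _ hYc) (hci _ _ _ hPc.continuousOn),
      hprojZ d hdeg, hq.integral_inner_mul_eval hab.le hdeg]
    ring
  -- For `i = r` the Galerkin derivative has degree below `r` and is orthogonal to `K_r`; only `Y'`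
  -- survives.
  have htop : ∫ x in a..b,
      inner ℝ (A (Y x) + R x - (A (p x) + q x)) (c r) * (locK a b r r).eval x =
      ∫ x in a..b, inner ℝ (A (Y x) + R x) (c r) * (locK a b r r).eval x := by
    set k := locK a b r r
    have h1 : ∀ x, inner ℝ (A (Y x) + R x - (A (p x) + q x)) (c r) * k.eval x =
        inner ℝ (A (Y x) + R x) (c r) * k.eval x -
          (inner ℝ (p x) (LinearMap.adjoint A (c r)) * k.eval x +
            inner ℝ (q x) (c r) * k.eval x) := fun x => by
      rw [inner_sub_left, inner_add_left (A (p x)), hadj (p x)]; ring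
    have hi : IntervalIntegrable (fun x => inner ℝ (A (Y x) + R x) (c r) * k.eval x)
        volume a b := by
      simp_rw [inner_add_left, hadj, add_mul]
      exact (hci _ _ _ hYc).add (hRi _ _)
    have hz : ∀ {v : ℝ → EuclideanSpace ℝ (Fin M)}, IsVecPoly (r - 1) v → ∀ d,
        ∫ x in a..b, inner ℝ (v x) d * k.eval x = 0 := by
      intro v hv d
      obtain ⟨kv, hkv, hev⟩ := hv.exists_inner_eq d
      simp_rw [hev]
      exact integral_mul_locK_self_eq_zero hab (by omega)
    simp_rw [h1]
    rw [intervalIntegral.integral_sub hi ((hci _ _ _ hpc).add (hci _ _ _ hqc)),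
      intervalIntegral.integral_add (hci _ _ _ hpc) (hci _ _ _ hqc), hz hp.1, hz hq.1]
    ring
  simp_rw [hparts]
  rw [Finset.sum_add_distrib, Finset.sum_range_succ, htop, Finset.sum_congr rfl
    fun i hi => hlow i (Finset.mem_range.1 hi), Finset.sum_range_succ' (fun i => ∫ x in a..b,
      inner ℝ (Y x - P x) (c i) * (derivative (locK a b r i)).eval x)]
  -- `K_{i+1}' = K_i` turns these into exactly the integrals with opposite sign from `hlow`; the
  -- index 0 term vanishes as `K_0` is constant.
  have hder : ∀ i ∈ Finset.range r, (∫ x in a..b,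
      inner ℝ (Y x - P x) (c (i + 1)) * (derivative (locK a b r (i + 1))).eval x) =
      ∫ x in a..b, inner ℝ (Y x - P x) (c (i + 1)) * (locK a b r i).eval x := by
    intro i hi
    rw [Finset.mem_range] at hi
    rw [derivative_locK_succ hab (by omega)]
  rw [Finset.sum_congr rfl hder, Finset.sum_neg_distrib, locK_zero]
  simp

end StepIdentity

/-! ### Functions with an integrable weak derivative are primitives of it. -/

section DuBoisReymond

variable {a b : ℝ}

lemma setIntegral_Ioo_mul_eq_integral {φ : ℝ → ℝ} (hφ : tsupport φ ⊆ Ioo a b) (w : ℝ → ℝ) :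
    ∫ x in Ioo a b, φ x * w x = ∫ x, φ x * w x := by
  refine setIntegral_eq_integral_of_forall_compl_eq_zero fun x hx => ?_
  rw [image_eq_zero_of_notMem_tsupport fun h => hx (hφ h), zero_mul]

lemma intervalIntegral_eq_setIntegral_Ioo (hab : a ≤ b) (w : ℝ → ℝ) :
    ∫ x in a..b, w x = ∫ x in Ioo a b, w x := by
  rw [intervalIntegral.integral_of_le hab, integral_Ioc_eq_integral_Ioo]

lemma IntegrableOn.continuous_mul_Ioo {w : ℝ → ℝ} (hw : IntegrableOn w (Ioo a b)) {φ : ℝ → ℝ}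
    (hφ : Continuous φ) : IntegrableOn (fun x => φ x * w x) (Ioo a b) := by
  rw [← integrableOn_Icc_iff_integrableOn_Ioo] at hw ⊢
  exact hw.continuousOn_mul hφ.continuousOn isCompact_Icc

lemma exists_Icc_subset_Ioo_of_isCompact (hab : a < b) {K : Set ℝ} (hK : IsCompact K)
    (hKab : K ⊆ Ioo a b) : ∃ α β, a < α ∧ β < b ∧ K ⊆ Icc α β := by
  have hc : IsCompact (insert ((a + b) / 2) K) := hK.insert _
  have hsub : insert ((a + b) / 2) K ⊆ Ioo a b :=
    insert_subset ⟨by linarith, by linarith⟩ hKab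
  obtain ⟨α, hα⟩ := hc.exists_isLeast (insert_nonempty _ _)
  obtain ⟨β, hβ⟩ := hc.exists_isGreatest (insert_nonempty _ _)
  exact ⟨α, β, (hsub hα.1).1, (hsub hβ.1).2, fun x hx =>
    ⟨hα.2 (mem_insert_of_mem _ hx), hβ.2 (mem_insert_of_mem _ hx)⟩⟩

/-- A test function with vanishing mean is the derivative of a test function. -/
lemma exists_testFunction_primitive (hab : a < b) {η : ℝ → ℝ} (hη : ContDiff ℝ ∞ η)
    (hηc : HasCompactSupport η) (hηs : tsupport η ⊆ Ioo a b) (h0 : ∫ x, η x = 0) :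
    ∃ Φ : ℝ → ℝ, ContDiff ℝ ∞ Φ ∧ HasCompactSupport Φ ∧ tsupport Φ ⊆ Ioo a b ∧
      ∀ x, HasDerivAt Φ (η x) x := by
  obtain ⟨α, β, hα, hβ, hαβ⟩ := exists_Icc_subset_Ioo_of_isCompact hab hηc hηs
  have hd : ∀ x, HasDerivAt (fun x => ∫ y in a..x, η y) (η x) x := fun x =>
    intervalIntegral.integral_hasDerivAt_right (hη.continuous.intervalIntegrable _ _)
      (hη.continuous.stronglyMeasurableAtFilter _ _) hη.continuous.continuousAt
  have hz : ∀ x, x ∉ Icc α β → η x = 0 := fun x hx =>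
    image_eq_zero_of_notMem_tsupport fun h => hx (hαβ h)
  have hsupp : tsupport (fun x => ∫ y in a..x, η y) ⊆ Icc α β := by
    refine closure_minimal (fun x hx => ?_) isClosed_Icc
    by_contra hx'
    apply hx
    simp only
    rcases lt_or_ge x α with h | h
    · rw [intervalIntegral.integral_congr (g := fun _ => (0 : ℝ)) fun y hy => hz y fun hyI => ?_]
      · simp
      · have := (mem_uIcc.1 hy)
        rcases this with h1 | h1
        · linarith [hyI.1]
        · linarith [hyI.1]
    · have hxβ : β < x := by
        by_contra hle
        exact hx' ⟨h, not_lt.1 hle⟩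
      rw [intervalIntegral.integral_eq_integral_of_support_subset, h0]
      intro y hy
      have : y ∈ Icc α β := by
        by_contra hyI
        exact hy (hz y hyI)
      exact ⟨hα.trans_le this.1, this.2.trans hxβ.le⟩
  refine ⟨_, ?_, ?_, hsupp.trans fun x hx => ⟨hα.trans_le hx.1, hx.2.trans_lt hβ⟩, hd⟩
  · rw [contDiff_infty_iff_deriv]
    refine ⟨fun x => (hd x).differentiableAt, ?_⟩
    rw [funext fun x => (hd x).deriv]
    exact hη
  · exact isCompact_Icc.of_isClosed_subset (isClosed_tsupport _) hsupp

/-- The lemma of du Bois-Reymond. -/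
lemma ae_eq_const_of_integral_deriv_mul_eq_zero (hab : a < b) {F : ℝ → ℝ}
    (hF : IntegrableOn F (Ioo a b))
    (h : ∀ φ φ' : ℝ → ℝ, ContDiff ℝ ∞ φ → HasCompactSupport φ → tsupport φ ⊆ Ioo a b →
      (∀ x, HasDerivAt φ (φ' x) x) → ∫ x in Ioo a b, φ' x * F x = 0) :
    ∃ c, ∀ᵐ x ∂(volume.restrict (Ioo a b)), F x = c := by
  -- A bump of unit mass supported well inside the interval; the constant sought is the `ψ`-average
  -- of `F`.
  let ψb : ContDiffBump ((a + b) / 2) := ⟨(b - a) / 8, (b - a) / 4, by linarith, by linarith⟩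
  set ψ : ℝ → ℝ := ψb.normed volume
  have hψ : ContDiff ℝ ∞ ψ := ψb.contDiff_normed
  have hψc : HasCompactSupport ψ := ψb.hasCompactSupport_normed
  have hψs : tsupport ψ ⊆ Ioo a b := by
    rw [ψb.tsupport_normed_eq, Real.closedBall_eq_Icc]
    intro x hx
    simp only [ψb] at hx
    exact ⟨by linarith [hx.1], by linarith [hx.2]⟩
  have hψ1 : ∫ x, ψ x = 1 := ψb.integral_normed
  set c := ∫ x in Ioo a b, ψ x * F x
  refine ⟨c, ?_⟩
  have hFc : IntegrableOn (fun x => F x - c) (Ioo a b) :=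
    hF.sub (integrableOn_const (by simp))
  have key := isOpen_Ioo.ae_eq_zero_of_integral_contDiff_smul_eq_zero (μ := volume)
    hFc.locallyIntegrableOn ?_
  · rw [ae_restrict_iff' measurableSet_Ioo]
    exact key.mono fun x hx hxI => sub_eq_zero.1 (hx hxI)
  · intro φ hφ hφc hφs
    -- Subtracting `I ψ` makes the test function mean-free, hence a derivative of a test function.
    set I := ∫ x, φ x
    have hηs : tsupport (fun x => φ x - I * ψ x) ⊆ Ioo a b := by
      refine (tsupport_sub φ fun x => I * ψ x).trans (union_subset hφs ?_)
      exact (tsupport_mul_subset_right (f := fun _ => I) (g := ψ)).trans hψs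
    have hφi : Integrable φ := hφ.continuous.integrable_of_hasCompactSupport hφc
    have hψi : Integrable ψ := hψ.continuous.integrable_of_hasCompactSupport hψc
    obtain ⟨Φ, hΦ, hΦc, hΦs, hΦd⟩ := exists_testFunction_primitive hab
      (η := fun x => φ x - I * ψ x) (hφ.sub (contDiff_const.mul hψ))
      (hφc.sub (hψc.mul_left (f := fun _ => I))) hηs (by
        rw [integral_sub hφi (hψi.const_mul I), integral_const_mul, hψ1, mul_one, sub_self])
    have h1 := h Φ _ hΦ hΦc hΦs hΦd
    have hφF := IntegrableOn.continuous_mul_Ioo hF hφ.continuous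
    have hψF := IntegrableOn.continuous_mul_Ioo hF hψ.continuous
    have h2 : ∀ x, (φ x - I * ψ x) * F x = φ x * F x - I * (ψ x * F x) := fun x => by ring
    simp_rw [h2] at h1
    rw [integral_sub hφF (hψF.const_mul I), integral_const_mul] at h1
    simp only [smul_eq_mul]
    rw [← setIntegral_Ioo_mul_eq_integral hφs]
    have h3 : ∀ x, φ x * (F x - c) = φ x * F x - c * (φ x * 1) := fun x => by ring
    simp_rw [h3]
    have hφ1 : IntegrableOn (fun x => φ x * 1) (Ioo a b) := by
      simpa using hφi.integrableOn
    rw [integral_sub hφF (hφ1.const_mul c), integral_const_mul,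
      setIntegral_Ioo_mul_eq_integral hφs fun _ => 1]
    simp only [mul_one]
    linarith

lemma IntegrableOn.intervalIntegrable_of_Ioo (hab : a ≤ b) {g : ℝ → ℝ}
    (hg : IntegrableOn g (Ioo a b)) : IntervalIntegrable g volume a b := by
  rwa [intervalIntegrable_iff_integrableOn_Ioo_of_le hab]

lemma IntegrableOn.ae_hasDerivAt_primitive (hab : a ≤ b) {g : ℝ → ℝ}
    (hg : IntegrableOn g (Ioo a b)) (c : ℝ) :
    AbsolutelyContinuousOnInterval (fun x => c + ∫ y in a..x, g y) a b ∧
      ∀ᵐ x ∂(volume.restrict (Ioo a b)), HasDerivAt (fun x => c + ∫ y in a..x, g y) (g x) x := by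
  have hi := IntegrableOn.intervalIntegrable_of_Ioo hab hg
  constructor
  · exact (contDiff_const (c := c) (n := 1)).contDiffOn.absolutelyContinuousOnInterval.fun_add
      (hi.absolutelyContinuousOnInterval_intervalIntegral left_mem_uIcc)
  · have h := hi.ae_hasDerivAt_integral
    rw [ae_restrict_iff' measurableSet_Ioo]
    filter_upwards [h] with x hx hxI
    have hxu : x ∈ uIcc a b := by
      rw [uIcc_of_le hab]; exact Ioo_subset_Icc_self hxI
    exact (hx hxu a left_mem_uIcc).const_add c

lemma AbsolutelyContinuousOnInterval.integral_testFunction (hab : a ≤ b) {f f' : ℝ → ℝ}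
    (hf : AbsolutelyContinuousOnInterval f a b)
    (hf' : ∀ᵐ x ∂(volume.restrict (Ioo a b)), HasDerivAt f (f' x) x) {φ φ' : ℝ → ℝ}
    (hφ : ContDiff ℝ ∞ φ) (hφs : tsupport φ ⊆ Ioo a b) (hφ' : ∀ x, HasDerivAt φ (φ' x) x) :
    ∫ x in Ioo a b, φ' x * f x = -∫ x in Ioo a b, φ x * f' x := by
  have hz : ∀ x ∉ Ioo a b, φ x = 0 := fun x hx =>
    image_eq_zero_of_notMem_tsupport fun h => hx (hφs h)
  have h := hf.integral_mul_contDiff hab hf' (hφ.of_le (by exact_mod_cast le_top)) hφ'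
  rw [hz a (by simp), hz b (by simp), intervalIntegral_eq_setIntegral_Ioo hab,
    intervalIntegral_eq_setIntegral_Ioo hab] at h
  simp_rw [mul_comm (φ' _), mul_comm (φ _)]
  linarith

/-- A function with an integrable weak derivative is a primitive of it. -/
lemma ae_eq_primitive_of_weakDeriv (hab : a < b) {u g : ℝ → ℝ} (hu : IntegrableOn u (Ioo a b))
    (hg : IntegrableOn g (Ioo a b))
    (h : ∀ φ φ' : ℝ → ℝ, ContDiff ℝ ∞ φ → HasCompactSupport φ → tsupport φ ⊆ Ioo a b →
      (∀ x, HasDerivAt φ (φ' x) x) →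
      ∫ x in Ioo a b, φ' x * u x = -∫ x in Ioo a b, φ x * g x) :
    ∃ c, ∀ᵐ x ∂(volume.restrict (Ioo a b)), u x = c + ∫ y in a..x, g y := by
  obtain ⟨hW, hW'⟩ := IntegrableOn.ae_hasDerivAt_primitive hab.le hg 0
  have hWi : IntegrableOn (fun x => 0 + ∫ y in a..x, g y) (Ioo a b) := by
    have := hW.continuousOn
    rw [uIcc_of_le hab.le] at this
    exact this.integrableOn_Icc.mono_set Ioo_subset_Icc_self
  obtain ⟨c, hc⟩ := ae_eq_const_of_integral_deriv_mul_eq_zero hab (hu.sub hWi) (by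
    intro φ φ' hφ hφc hφs hφ'
    have hφ'c : Continuous φ' := by
      rw [← funext fun x => (hφ' x).deriv]
      exact hφ.continuous_deriv (by exact_mod_cast le_top)
    simp only [Pi.sub_apply, mul_sub]
    rw [integral_sub (IntegrableOn.continuous_mul_Ioo hu hφ'c)
      (IntegrableOn.continuous_mul_Ioo hWi hφ'c), h φ φ' hφ hφc hφs hφ',
      hW.integral_testFunction hab.le hW' hφ hφs hφ']
    ring)
  refine ⟨c, hc.mono fun x hx => ?_⟩
  simp only [Pi.sub_apply] at hx
  linarith

-- The polynomial only vanishes at the ends of a subinterval and is not a test function there.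
-- Replacing `u` by its absolutely continuous representative makes classical integration by parts
-- available.
open Polynomial in
lemma integral_mul_derivative_of_weakDeriv (hab : a < b) {u g : ℝ → ℝ}
    (hu : IntegrableOn u (Ioo a b)) (hg : IntegrableOn g (Ioo a b))
    (h : ∀ φ φ' : ℝ → ℝ, ContDiff ℝ ∞ φ → HasCompactSupport φ → tsupport φ ⊆ Ioo a b →
      (∀ x, HasDerivAt φ (φ' x) x) →
      ∫ x in Ioo a b, φ' x * u x = -∫ x in Ioo a b, φ x * g x)
    {α β : ℝ} (hα : a ≤ α) (hαβ : α ≤ β) (hβ : β ≤ b) {k : ℝ[X]} (hkα : k.eval α = 0)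
    (hkβ : k.eval β = 0) :
    ∫ x in α..β, u x * (derivative k).eval x = -∫ x in α..β, g x * k.eval x := by
  obtain ⟨c, hc⟩ := ae_eq_primitive_of_weakDeriv hab hu hg h
  obtain ⟨hW, hW'⟩ := IntegrableOn.ae_hasDerivAt_primitive hab.le hg c
  have hsub : Ioo α β ⊆ Ioo a b := Ioo_subset_Ioo hα hβ
  have hW1 : AbsolutelyContinuousOnInterval (fun x => c + ∫ y in a..x, g y) α β := by
    refine hW.mono ?_
    rw [uIcc_of_le hαβ, uIcc_of_le hab.le]
    exact Icc_subset_Icc hα hβ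
  have h1 := hW1.integral_mul_eval hαβ (ae_restrict_of_ae_restrict_of_subset hsub hW') k
  rw [hkα, hkβ] at h1
  have h2 : ∫ x in α..β, u x * (derivative k).eval x =
      ∫ x in α..β, (c + ∫ y in a..x, g y) * (derivative k).eval x := by
    rw [intervalIntegral_eq_setIntegral_Ioo hαβ, intervalIntegral_eq_setIntegral_Ioo hαβ]
    refine integral_congr_ae ?_
    filter_upwards [ae_restrict_of_ae_restrict_of_subset hsub hc] with x hx
    rw [hx]
  rw [h2]
  linarith

end DuBoisReymond

/-! ### Weak derivatives of the data tested with Legendre polynomials. -/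

section WeakDerivatives

variable {E : Type*} [NormedAddCommGroup E] [InnerProductSpace ℝ E] {a b s : ℝ}

lemma MemHs.isWeakDeriv {v : ℝ → E} (h : MemHs a b s v) {j : ℕ} (hj : j ≤ ⌊s⌋₊) :
    IsWeakDeriv a b j v (weakDeriv a b j v) := by
  have hex := (h.1 j hj).1
  rw [weakDeriv, dif_pos hex]
  exact hex.choose_spec

lemma MemHs.integrableOn {v : ℝ → E} (h : MemHs a b s v) {j : ℕ} (hj : j ≤ ⌊s⌋₊) :
    IntegrableOn (weakDeriv a b j v) (Ioo a b) :=
  (h.1 j hj).2.integrable (by norm_num)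

lemma IntegrableOn.continuous_smul_Ioo {w : ℝ → E} (hw : IntegrableOn w (Ioo a b)) {φ : ℝ → ℝ}
    (hφ : Continuous φ) : IntegrableOn (fun x => φ x • w x) (Ioo a b) := by
  rw [← integrableOn_Icc_iff_integrableOn_Ioo] at hw ⊢
  exact hw.continuousOn_smul hφ.continuousOn isCompact_Icc

lemma integral_mul_inner_eq [CompleteSpace E] {w : ℝ → E} (hw : IntegrableOn w (Ioo a b))
    {φ : ℝ → ℝ} (hφ : Continuous φ) (G : E) :
    ∫ x in Ioo a b, φ x * inner ℝ (w x) G = inner ℝ (∫ x in Ioo a b, φ x • w x) G := by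
  rw [real_inner_comm, ← integral_inner (IntegrableOn.continuous_smul_Ioo hw hφ)]
  refine integral_congr_ae (Filter.Eventually.of_forall fun x => ?_)
  simp only [real_inner_smul_right, real_inner_comm]

/-- Consecutive weak derivatives are weak derivatives of each other. -/
lemma IsWeakDeriv.integral_testFunction_inner [CompleteSpace E] {v f g : ℝ → E} {j : ℕ}
    (hf : IsWeakDeriv a b j v f) (hg : IsWeakDeriv a b (j + 1) v g)
    (hfi : IntegrableOn f (Ioo a b)) (hgi : IntegrableOn g (Ioo a b)) (G : E) {φ φ' : ℝ → ℝ}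
    (hφ : ContDiff ℝ ∞ φ) (hφc : HasCompactSupport φ) (hφs : tsupport φ ⊆ Ioo a b)
    (hφ' : ∀ x, HasDerivAt φ (φ' x) x) :
    ∫ x in Ioo a b, φ' x * inner ℝ (f x) G = -∫ x in Ioo a b, φ x * inner ℝ (g x) G := by
  have hd : deriv φ = φ' := funext fun x => (hφ' x).deriv
  have hφ'd : ContDiff ℝ ∞ φ' := by
    rw [← hd]
    exact (contDiff_infty_iff_deriv.1 hφ).2
  -- Testing the order `j` derivative with `φ'` and the order `j + 1` derivative with `φ` gives the
  -- same integral of `φ^{(j+1)}` against `v`.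
  have h1 := hf.2.2 φ' hφ'd (hd ▸ hφc.deriv) (hd ▸ (tsupport_deriv_subset (𝕜 := ℝ)).trans hφs)
  have h2 := hg.2.2 φ hφ hφc hφs
  rw [iteratedDeriv_succ', hd, h1, pow_succ, mul_smul] at h2
  have h3 : ∫ x in Ioo a b, φ' x • f x = (-1 : ℝ) • ∫ x in Ioo a b, φ x • g x :=
    smul_right_injective E (pow_ne_zero j (by norm_num : (-1 : ℝ) ≠ 0)) h2
  rw [integral_mul_inner_eq hfi hφ'd.continuous, integral_mul_inner_eq hgi hφ.continuous, h3,
    real_inner_smul_left]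
  ring

/-- The classical almost everywhere derivative is the weak derivative. -/
lemma ae_eq_inner_weakDeriv_one [CompleteSpace E] (hab : a < b) {v f : ℝ → E}
    (hf : IsWeakDeriv a b 1 v f) (hv : IntegrableOn v (Ioo a b)) (hfi : IntegrableOn f (Ioo a b))
    (G : E) {u' : ℝ → ℝ}
    (hu : AbsolutelyContinuousOnInterval (fun x => inner ℝ (v x) G) a b)
    (hu' : ∀ᵐ x ∂(volume.restrict (Ioo a b)), HasDerivAt (fun x => inner ℝ (v x) G) (u' x) x) :
    ∀ᵐ x ∂(volume.restrict (Ioo a b)), u' x = inner ℝ (f x) G := by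
  have hu'i : IntegrableOn u' (Ioo a b) :=
    (intervalIntegrable_iff_integrableOn_Ioo_of_le hab.le).1
      (hu.integral_eq_sub_of_ae_hasDerivAt hab.le hu').1
  have hfG : IntegrableOn (fun x => inner ℝ (f x) G) (Ioo a b) := hfi.inner_const G
  have key := isOpen_Ioo.ae_eq_zero_of_integral_contDiff_smul_eq_zero (μ := volume)
    (hu'i.sub hfG).locallyIntegrableOn ?_
  · rw [ae_restrict_iff' measurableSet_Ioo]
    exact key.mono fun x hx hxI => sub_eq_zero.1 (hx hxI)
  · intro φ hφ hφc hφs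
    have hφ' : ∀ x, HasDerivAt φ (deriv φ x) x := fun x =>
      ((contDiff_infty_iff_deriv.1 hφ).1 x).hasDerivAt
    have hφ'c : Continuous (deriv φ) := hφ.continuous_deriv (by exact_mod_cast le_top)
    have h1 := hu.integral_testFunction hab.le hu' hφ hφs hφ'
    have h2 := hf.2.2 φ hφ hφc hφs
    rw [iteratedDeriv_one, pow_one] at h2
    rw [integral_mul_inner_eq hv hφ'c, h2, real_inner_smul_left,
      ← integral_mul_inner_eq hfi hφ.continuous] at h1
    simp only [smul_eq_mul]
    rw [← setIntegral_Ioo_mul_eq_integral hφs]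
    simp only [Pi.sub_apply, mul_sub]
    rw [integral_sub (IntegrableOn.continuous_mul_Ioo hu'i hφ.continuous)
      (IntegrableOn.continuous_mul_Ioo hfG hφ.continuous)]
    linarith

/-- Moving derivatives from the Legendre polynomial to the data. -/
lemma MemHs.integral_weakDeriv_mul_locK [CompleteSpace E] (hab : a < b) {v : ℝ → E}
    (h : MemHs a b s v) {α β : ℝ} (hα : a ≤ α) (hαβ : α < β) (hβ : β ≤ b) (G : E) {r m : ℕ}
    (hm : m ≤ r) (hms : m + 1 ≤ ⌊s⌋₊) :
    ∫ x in α..β, inner ℝ (weakDeriv a b 1 v x) G * (locK α β r r).eval x =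
      (-1) ^ m * ∫ x in α..β,
        inner ℝ (weakDeriv a b (m + 1) v x) G * (locK α β r (r + m)).eval x := by
  induction m with
  | zero => simp
  | succ m ih =>
    -- The next primitive `K_{r+m+1}` vanishes at both ends, so moving one more derivative has no
    -- boundary term.
    have hk := eval_locK_endpoints hαβ (r := r) (l := r + m + 1) (by omega) (by omega)
    have h1 := integral_mul_derivative_of_weakDeriv hab
      (Integrable.inner_const (h.integrableOn (j := m + 1) (by omega)) G)
      (Integrable.inner_const (h.integrableOn hms) G)
      (fun φ φ' hφ hφc hφs hφ' => (h.isWeakDeriv (by omega)).integral_testFunction_inner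
        (h.isWeakDeriv hms) (h.integrableOn (by omega)) (h.integrableOn hms) G hφ hφc hφs hφ')
      hα hαβ.le hβ hk.1 hk.2
    rw [derivative_locK_succ hαβ (by omega)] at h1
    rw [ih (by omega) (by omega), h1, pow_succ, ← add_assoc]
    ring

end WeakDerivatives

/-! ### Bounds of Legendre moments by `L²` norms and Gagliardo seminorms. -/

section LocalEstimates

variable {E : Type*} [NormedAddCommGroup E] [InnerProductSpace ℝ E] {a b : ℝ}

lemma sq_integral_inner_mul_le (hab : a ≤ b) {g : ℝ → E}
    (hg : MemLp g 2 (volume.restrict (Ioo a b))) (G : E) {k : ℝ → ℝ} (hk : Continuous k) :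
    (∫ x in a..b, inner ℝ (g x) G * k x) ^ 2 ≤
      ‖G‖ ^ 2 * (∫ x in a..b, k x ^ 2) * ∫ x in Ioo a b, ‖g x‖ ^ 2 := by
  simp only [intervalIntegral_eq_setIntegral_Ioo hab]
  have hki : ∀ u : ℝ → ℝ, Continuous u → IntegrableOn u (Ioo a b) := fun u hu =>
    hu.integrableOn_Icc.mono_set Ioo_subset_Icc_self
  have hgG : MemLp (fun x => inner ℝ (g x) G) 2 (volume.restrict (Ioo a b)) := hg.inner_const G
  have hgGi : IntegrableOn (fun x => inner ℝ (g x) G) (Ioo a b) := hgG.integrable (by norm_num)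
  have hgk : IntegrableOn (fun x => inner ℝ (g x) G * k x) (Ioo a b) := by
    simp_rw [mul_comm _ (k _)]
    exact IntegrableOn.continuous_mul_Ioo hgGi hk
  have h1 := sq_integral_mul_le hgG.integrable_sq (hki _ (hk.pow 2)) hgk
  have h2 : ∫ x in Ioo a b, inner ℝ (g x) G ^ 2 ≤ ∫ x in Ioo a b, ‖G‖ ^ 2 * ‖g x‖ ^ 2 := by
    refine integral_mono hgG.integrable_sq
      ((hg.integrable_norm_pow (by norm_num)).const_mul _) fun x => ?_
    simp only
    rw [← mul_pow, ← sq_abs, mul_comm]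
    gcongr
    exact abs_real_inner_le_norm _ _
  rw [integral_const_mul] at h2
  calc _ ≤ _ := h1
    _ ≤ (‖G‖ ^ 2 * ∫ x in Ioo a b, ‖g x‖ ^ 2) * ∫ x in Ioo a b, k x ^ 2 := by
        gcongr
    _ = _ := by ring

/-- Both points lie in the interval, so `|x - y| ≤ b - a` and the singular kernel is bounded below.
-/
lemma ofReal_integral_norm_sub_sq_le {F : Type*} [NormedAddCommGroup F] {σ : ℝ} (hσ : 0 ≤ σ)
    {g : ℝ → F}
    (hg : MemLp g 2 (volume.restrict (Ioo a b))) {x : ℝ} (hx : x ∈ Ioo a b) :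
    ENNReal.ofReal (∫ y in Ioo a b, ‖g y - g x‖ ^ 2) ≤ ENNReal.ofReal ((b - a) ^ (1 + 2 * σ)) *
      ∫⁻ y in Ioo a b, ENNReal.ofReal (‖g x - g y‖ ^ 2 / |x - y| ^ (1 + 2 * σ)) := by
  have hgx : MemLp (fun y => g y - g x) 2 (volume.restrict (Ioo a b)) := hg.sub (memLp_const _)
  rw [ofReal_integral_eq_lintegral_ofReal (hgx.integrable_norm_pow (by norm_num))
    (Filter.Eventually.of_forall fun y => by positivity),
    ← lintegral_const_mul' _ _ ENNReal.ofReal_ne_top]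
  refine setLIntegral_mono' measurableSet_Ioo fun y hy => ?_
  have hba : 0 ≤ b - a := by linarith [hx.1, hx.2]
  rw [← ENNReal.ofReal_mul (by positivity)]
  refine ENNReal.ofReal_le_ofReal ?_
  rcases eq_or_ne x y with rfl | hne
  · simp
  · have h1 : 0 < |x - y| := abs_pos.2 (sub_ne_zero.2 hne)
    have h2 : |x - y| ≤ b - a := by
      rw [abs_le]; constructor <;> linarith [hx.1, hx.2, hy.1, hy.2]
    have h3 : |x - y| ^ (1 + 2 * σ) ≤ (b - a) ^ (1 + 2 * σ) :=
      Real.rpow_le_rpow h1.le h2 (by linarith)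
    have h4 : 0 < |x - y| ^ (1 + 2 * σ) := Real.rpow_pos_of_pos h1 _
    rw [norm_sub_rev, mul_div_assoc', le_div_iff₀ h4, mul_comm]
    gcongr

/-- As `k` has mean zero, `g(y)` may be replaced by `g(y) - g(x)` for any fixed `x`. Cauchy–Schwarz
in `y` followed by integration in `x` produces the seminorm; the left side is constant in `x`, which
returns one factor `b - a` and leaves `(b - a)^{2σ}`. -/
lemma sq_integral_inner_mul_le_gagliardo (hab : a < b) {σ : ℝ} (hσ : 0 ≤ σ) {g : ℝ → E}
    (hg : MemLp g 2 (volume.restrict (Ioo a b))) (hfin : gagliardoSq a b σ g ≠ ⊤) (G : E)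
    {k : ℝ → ℝ} (hk : Continuous k) (hk0 : ∫ x in a..b, k x = 0) :
    (∫ x in a..b, inner ℝ (g x) G * k x) ^ 2 ≤
      ‖G‖ ^ 2 * (∫ x in a..b, k x ^ 2) * ((b - a) ^ (2 * σ) * (gagliardoSq a b σ g).toReal) := by
  set X := ∫ x in a..b, inner ℝ (g x) G * k x
  set K := ∫ x in a..b, k x ^ 2
  have hba : 0 < b - a := sub_pos.2 hab
  have hK : 0 ≤ K := intervalIntegral.integral_nonneg hab.le fun x _ => sq_nonneg _
  have hpt : ∀ x ∈ Ioo a b, ENNReal.ofReal (X ^ 2) ≤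
      ENNReal.ofReal (‖G‖ ^ 2 * K * (b - a) ^ (1 + 2 * σ)) *
        ∫⁻ y in Ioo a b, ENNReal.ofReal (‖g x - g y‖ ^ 2 / |x - y| ^ (1 + 2 * σ)) := by
    intro x hx
    have hgx : MemLp (fun y => g y - g x) 2 (volume.restrict (Ioo a b)) := hg.sub (memLp_const _)
    have hgGi : IntervalIntegrable (fun y => inner ℝ (g y) G) volume a b :=
      IntegrableOn.intervalIntegrable_of_Ioo hab.le ((hg.inner_const G).integrable (by norm_num))
    have hX : X = ∫ y in a..b, inner ℝ (g y - g x) G * k y := by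
      simp_rw [inner_sub_left, sub_mul]
      rw [intervalIntegral.integral_sub (hgGi.mul_continuousOn hk.continuousOn)
        ((hk.intervalIntegrable _ _).const_mul _), intervalIntegral.integral_const_mul, hk0]
      simp [X]
    have h1 := sq_integral_inner_mul_le hab.le hgx G hk
    rw [← hX] at h1
    calc ENNReal.ofReal (X ^ 2)
        ≤ ENNReal.ofReal (‖G‖ ^ 2 * K * ∫ y in Ioo a b, ‖g y - g x‖ ^ 2) :=
          ENNReal.ofReal_le_ofReal h1
      _ = ENNReal.ofReal (‖G‖ ^ 2 * K) * ENNReal.ofReal (∫ y in Ioo a b, ‖g y - g x‖ ^ 2) :=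
          ENNReal.ofReal_mul (by positivity)
      _ ≤ _ := by
          rw [ENNReal.ofReal_mul (by positivity : 0 ≤ ‖G‖ ^ 2 * K), mul_assoc]
          gcongr
          exact ofReal_integral_norm_sub_sq_le hσ hg hx
  have hint := setLIntegral_mono' (μ := volume) measurableSet_Ioo hpt
  rw [setLIntegral_const, Real.volume_Ioo, lintegral_const_mul' _ _ ENNReal.ofReal_ne_top,
    ← ENNReal.ofReal_mul (sq_nonneg X)] at hint
  have hreal := ENNReal.toReal_mono (ENNReal.mul_ne_top ENNReal.ofReal_ne_top hfin) hint
  rw [ENNReal.toReal_mul, ENNReal.toReal_ofReal (by positivity),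
    ENNReal.toReal_ofReal (by positivity)] at hreal
  rw [Real.rpow_add hba, Real.rpow_one] at hreal
  refine le_of_mul_le_mul_right ?_ hba
  calc X ^ 2 * (b - a) ≤ _ := hreal
    _ = _ := by rw [gagliardoSq]; ring

end LocalEstimates

/-! ### Summing steps and local energies over a partition. -/

section Summation

variable {N : ℕ} {t : Fin (N + 1) → ℝ} {T : ℝ}

lemma IsPartition.Ioo_subset (ht : IsPartition T t) (k : Fin N) :
    Ioo (t k.castSucc) (t k.succ) ⊆ Ioo 0 T := by
  refine Ioo_subset_Ioo ?_ ?_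
  · rw [← ht.2.1]; exact ht.1.monotone (Fin.zero_le _)
  · rw [← ht.2.2]; exact ht.1.monotone (Fin.le_last _)

lemma IsPartition.sum_step (ht : IsPartition T t) :
    ∑ k : Fin N, (t k.succ - t k.castSucc) = T := by
  have key : ∀ (n : ℕ) (f : Fin (n + 1) → ℝ),
      ∑ k : Fin n, (f k.succ - f k.castSucc) = f (Fin.last n) - f 0 := by
    intro n f
    have h1 := Fin.sum_univ_succ f
    have h2 := Fin.sum_univ_castSucc f
    rw [Finset.sum_sub_distrib]
    linarith
  rw [key, ht.2.1, ht.2.2, sub_zero]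

lemma IsPartition.sum_lintegral_le (ht : IsPartition T t) (F : ℝ → ℝ≥0∞) :
    ∑ k : Fin N, ∫⁻ x in Ioo (t k.castSucc) (t k.succ), F x ≤ ∫⁻ x in Ioo 0 T, F x := by
  have hdisj : Pairwise (Function.onFun Disjoint fun k : Fin N =>
      Ioo (t k.castSucc) (t k.succ)) := by
    have aux : ∀ i j : Fin N, i < j →
        Disjoint (Ioo (t i.castSucc) (t i.succ)) (Ioo (t j.castSucc) (t j.succ)) := by
      intro i j hij
      rw [Set.disjoint_left]
      intro x hx hy
      have : t i.succ ≤ t j.castSucc := ht.1.monotone (Fin.succ_le_castSucc_iff.2 hij)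
      linarith [hx.2, hy.1]
    intro i j hij
    rcases lt_or_gt_of_ne hij with h | h
    · exact aux i j h
    · exact (aux j i h).symm
  rw [← tsum_fintype (L := .unconditional _), ← lintegral_iUnion (fun k => measurableSet_Ioo) hdisj]
  exact lintegral_mono_set (iUnion_subset ht.Ioo_subset)

lemma step_le_maxStep (t : Fin (N + 1) → ℝ) (k : Fin N) : t k.succ - t k.castSucc ≤ maxStep t :=
  le_ciSup (f := fun k : Fin N => t k.succ - t k.castSucc) (Set.finite_range _).bddAbove k

end Summation

/-! ### Error propagation over one step and its constant. -/

section Superconvergence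

variable {M N r : ℕ} {a b : ℝ}

lemma krylov_smul {E : Type*} [NormedAddCommGroup E] [InnerProductSpace ℝ E] (B : E →ₗ[ℝ] E)
    (θ : ℝ) (G : E) (i : ℕ) : krylov (θ • B) G i = θ ^ i • krylov B G i := by
  simp [krylov, smul_pow]

/-- Propagation of the nodal error over one interval. -/
lemma galerkin_step_error (hab : a < b) (hr : 1 ≤ r)
    {A : EuclideanSpace ℝ (Fin M) →ₗ[ℝ] EuclideanSpace ℝ (Fin M)}
    (hA : ∀ x, inner ℝ (A x) x ≤ 0)
    {R Y Z p q : ℝ → EuclideanSpace ℝ (Fin M)} (hR : IntegrableOn R (Ioo a b))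
    (hY : AbsolutelyContinuousOnInterval Y a b)
    (hY' : ∀ᵐ x ∂(volume.restrict (Ioo a b)), HasDerivAt Y (A (Y x) + R x) x)
    (hZ : ContinuousOn Z (Icc a b)) (hZr : ∃ P, IsVecPoly r P ∧ EqOn Z P (Ioo a b))
    (hp : IsLocalProj a b (r - 1) Z p) (hq : IsLocalProj a b (r - 1) R q)
    (hZ' : ∀ x ∈ Ioo a b, HasDerivAt Z (A (p x) + q x) x) {δ : ℝ}
    (hδ0 : 0 ≤ δ) (hδ : ∀ G, |∫ x in a..b, inner ℝ ((A ^ r) (A (Y x) + R x)) G * (locK a b r r).eval x| ≤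
      δ * ‖G‖) :
    ‖Y b - Z b‖ ≤ ‖Y a - Z a‖ + δ * adjConst r := by
  -- Minus the adjoint is accretive because `A` is dissipative; the half-length `θ` rescales the
  -- problem to `[-1, 1]`.
  set B := -LinearMap.adjoint A
  set θ := (b - a) / 2
  have hθ : 0 < θ := by simp only [θ]; linarith
  have hB : ∀ x, 0 ≤ inner ℝ ((θ • B) x) x := by
    intro x
    have : inner ℝ ((θ • B) x) x = -(θ * inner ℝ (A x) x) := by
      simp only [B, LinearMap.smul_apply, LinearMap.neg_apply, real_inner_smul_left,
        inner_neg_left, LinearMap.adjoint_inner_left]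
      rw [real_inner_comm]
      ring
    rw [this]
    have := mul_nonneg hθ.le (neg_nonneg.2 (hA x))
    linarith
  -- Taking the error at `b` as terminal value of the adjoint turns the left side of the identity
  -- into its squared norm.
  obtain ⟨G, hG⟩ := exists_legSum_one_eq hr hB (Y b - Z b)
  have hstep := galerkin_step_identity hab hr A hR hY hY' hZ hZr hp hq hZ' (c := krylov B G)
    (fun i => by rw [krylov_succ]; rfl)
  have hends : ∀ (v : EuclideanSpace ℝ (Fin M)) (y : ℝ),
      ∑ i ∈ Finset.range (r + 1), inner ℝ v (krylov B G i) * (θ ^ i * (legK r i).eval y) =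
        inner ℝ v (legSum r (r + 1) (krylov (θ • B) G) y) := by
    intro v y
    simp only [legSum, inner_sum, krylov_smul, real_inner_smul_right]
    exact Finset.sum_congr rfl fun i _ => by ring
  simp_rw [eval_locK_right hab, eval_locK_left hab] at hstep
  rw [Finset.sum_sub_distrib, hends, hends, hG, real_inner_self_eq_norm_sq] at hstep
  have hpow : ∀ (v : EuclideanSpace ℝ (Fin M)) (i : ℕ),
      inner ℝ v (krylov B G i) = (-1) ^ i * inner ℝ ((A ^ i) v) G := by
    intro v i
    induction i generalizing v with
    | zero => simp [krylov]
    | succ i ih =>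
      have : inner ℝ v (krylov B G (i + 1)) = -inner ℝ (A v) (krylov B G i) := by
        rw [krylov_succ]
        simp only [B, LinearMap.neg_apply, inner_neg_right, LinearMap.adjoint_inner_right]
      rw [this, ih, pow_succ A, Module.End.mul_apply]
      ring
  have hint : |∫ x in a..b, inner ℝ (A (Y x) + R x) (krylov B G r) * (locK a b r r).eval x| ≤
      δ * ‖G‖ := by
    simp_rw [hpow, mul_assoc]
    rw [intervalIntegral.integral_const_mul, abs_mul, abs_pow, abs_neg, abs_one, one_pow, one_mul]
    exact hδ G
  have hGn := norm_le_adjConst_mul hr hB G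
  have hleft := norm_legSum_neg_one_le hr hB G
  rw [hG] at hGn hleft
  have hin : inner ℝ (Y a - Z a) (legSum r (r + 1) (krylov (θ • B) G) (-1)) ≤
      ‖Y a - Z a‖ * ‖Y b - Z b‖ :=
    (real_inner_le_norm _ _).trans (by gcongr)
  have hle := (le_abs_self _).trans hint
  have h1 : ‖Y b - Z b‖ * ‖Y b - Z b‖ ≤ (‖Y a - Z a‖ + δ * adjConst r) * ‖Y b - Z b‖ := by
    have := mul_le_mul_of_nonneg_left hGn hδ0
    nlinarith
  rcases (norm_nonneg (Y b - Z b)).eq_or_lt with h0 | h0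
  · rw [← h0]
    have : 0 ≤ adjConst r := by unfold adjConst; positivity
    positivity
  · exact le_of_mul_le_mul_right h1 h0

/-- The combined constant of the discrete adjoint and of the Legendre polynomials. -/
lemma adjConst_mul_sqrt_le (hr : 1 ≤ r) {m : ℕ} {h : ℝ} (hh : 0 ≤ h) :
    adjConst r * √((h / 2) ^ (2 * (r + m) + 1) * (4 ^ m * (2 / (2 * r).factorial))) ≤
      5 * (3 / 4) ^ r * (h ^ (r + m) * √h) := by
  have hfact : ((2 * r).factorial : ℝ) = (2 * r) * (2 * r - 1) * (2 * r - 2).factorial := by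
    obtain ⟨n, rfl⟩ := Nat.exists_eq_add_of_le hr
    rw [show 2 * (1 + n) = 2 * n + 1 + 1 by ring, Nat.factorial_succ, Nat.factorial_succ,
      show 2 * n + 1 + 1 - 2 = 2 * n by omega]
    push_cast
    ring
  have hr1 : (1 : ℝ) ≤ r := by exact_mod_cast hr
  have hf0 : (0 : ℝ) < (2 * r - 2).factorial := by exact_mod_cast Nat.factorial_pos _
  have hprod : (2 * r - 2).factorial * r *
      ((h / 2) ^ (2 * (r + m) + 1) * (4 ^ m * (2 / ((2 * r).factorial : ℝ)))) ≤
      ((1 / 2) ^ r * h ^ (r + m)) ^ 2 * h := by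
    -- Here the factorial growth of the adjoint constant is absorbed: the quotient equals `1 / (2r -
    -- 1)`.
    have h1 : (2 * r - 2).factorial * r * (2 / ((2 * r).factorial : ℝ)) ≤ 1 := by
      rw [hfact, mul_div_assoc', div_le_one (by
        have : (0 : ℝ) < 2 * r - 1 := by linarith
        positivity)]
      have : 0 ≤ ((2 * r - 2).factorial : ℝ) * (r * (2 * r - 2)) := by
        have : (0 : ℝ) ≤ 2 * r - 2 := by linarith
        positivity
      linarith
    have h4 : (4 : ℝ) ^ m = (2 ^ m) ^ 2 := by rw [← pow_mul, mul_comm, pow_mul]; norm_num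
    have h2 : (h / 2) ^ (2 * (r + m) + 1) * 4 ^ m = ((1 / 2) ^ r * h ^ (r + m)) ^ 2 * (h / 2) := by
      rw [h4, pow_succ, mul_comm 2 (r + m), pow_mul, div_pow, pow_add 2 r m, one_div_pow]
      field_simp
    calc _ = ((2 * r - 2).factorial * r * (2 / ((2 * r).factorial : ℝ))) *
          ((h / 2) ^ (2 * (r + m) + 1) * 4 ^ m) := by ring
      _ ≤ 1 * ((h / 2) ^ (2 * (r + m) + 1) * 4 ^ m) := by gcongr
      _ = ((1 / 2) ^ r * h ^ (r + m)) ^ 2 * (h / 2) := by rw [one_mul, h2]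
      _ ≤ _ := by
          gcongr
          linarith
  rw [adjConst, mul_assoc (5 * (3 / 2) ^ r : ℝ), ← Real.sqrt_mul (by positivity)]
  calc _ ≤ 5 * (3 / 2) ^ r * √(((1 / 2) ^ r * h ^ (r + m)) ^ 2 * h) := by gcongr
    _ = 5 * ((3 / 2) ^ r * (1 / 2) ^ r) * (h ^ (r + m) * √h) := by
        rw [Real.sqrt_mul (by positivity), Real.sqrt_sq (by positivity)]
        ring
    _ = _ := by rw [← mul_pow]; norm_num

/-- Geometric decay beats any power of `r`; this is the only source of the final constant, which
hence depends on `s` alone. -/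
lemma exists_rpow_mul_geometric_le (s : ℝ) :
    ∃ C : ℝ, 0 < C ∧ ∀ r : ℕ, 1 ≤ r → 5 * (3 / 4 : ℝ) ^ r ≤ C / (r : ℝ) ^ s := by
  have h := tendsto_pow_const_mul_const_pow_of_abs_lt_one ⌈s⌉₊ (r := (3 / 4 : ℝ))
    (by rw [abs_of_pos] <;> norm_num)
  obtain ⟨C, hC⟩ := h.bddAbove_range
  refine ⟨5 * max C 1, by positivity, fun r hr => ?_⟩
  have hr1 : (1 : ℝ) ≤ r := by exact_mod_cast hr
  rw [le_div_iff₀ (Real.rpow_pos_of_pos (by linarith) _)]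
  have h1 : (r : ℝ) ^ s ≤ (r : ℝ) ^ ⌈s⌉₊ := by
    rw [← Real.rpow_natCast]
    exact Real.rpow_le_rpow_of_exponent_le hr1 (Nat.le_ceil s)
  have h2 := hC (mem_range_self r)
  have h3 := le_max_left C 1
  have h4 : (r : ℝ) ^ s * (3 / 4) ^ r ≤ (r : ℝ) ^ ⌈s⌉₊ * (3 / 4) ^ r := by gcongr
  nlinarith

end Superconvergence

/-! ### Step bounds by superadditive energies, and the theorem. -/

section MainTheorem

lemma inner_toEuclideanLin_self_nonpos {M : ℕ} {D : Matrix (Fin M) (Fin M) ℝ}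
    (hD : (-(D + D.transpose)).PosSemidef) (x : EuclideanSpace ℝ (Fin M)) :
    inner ℝ (D.toEuclideanLin x) x ≤ 0 := by
  have h := (Matrix.isPositive_toEuclideanLin_iff.2 hD).inner_nonneg_left x
  rw [← Matrix.conjTranspose_eq_transpose_of_trivial, map_neg, map_add,
    Matrix.toEuclideanLin_conjTranspose_eq_adjoint, LinearMap.neg_apply, LinearMap.add_apply,
    inner_neg_left, inner_add_left, LinearMap.adjoint_inner_left, real_inner_comm x] at h
  linarith [real_inner_comm x (D.toEuclideanLin x)]

variable {E : Type*} [NormedAddCommGroup E] [InnerProductSpace ℝ E] {T s : ℝ} {v : ℝ → E}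

/-- From a bound of the Legendre coefficient by the energy of the data to the step constant. -/
lemma exists_step_bound {F : Type*} [NormedAddCommGroup F] {α β : ℝ} (hαβ : α < β) {r m : ℕ} (hr : 1 ≤ r) (hm : m ≤ r) {σ n : ℝ}
    (hn : 0 ≤ n) {X : F → ℝ}
    (hX : ∀ G, X G ^ 2 ≤ ‖G‖ ^ 2 * (∫ x in α..β, (locK α β r (r + m)).eval x ^ 2) *
      ((β - α) ^ (2 * σ) * n)) :
    ∃ δ, 0 ≤ δ ∧ (∀ G, |X G| ≤ δ * ‖G‖) ∧ δ * adjConst r ≤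
      5 * (3 / 4) ^ r * (β - α) ^ ((r : ℝ) + m + σ) * (√(β - α) * √n) := by
  have hh : 0 < β - α := sub_pos.2 hαβ
  set κ := ((β - α) / 2) ^ (2 * (r + m) + 1) * (4 ^ m * (2 / ((2 * r).factorial : ℝ)))
  have hκ : 0 ≤ κ := by positivity
  -- `√κ` bounds the `L²` norm of `K_{r+m}` on the step.
  refine ⟨√κ * ((β - α) ^ σ * √n), by positivity, fun G => ?_, ?_⟩
  · refine abs_le_of_sq_le_sq ?_ (by positivity)
    refine (hX G).trans ?_
    rw [mul_pow, mul_pow, mul_pow, Real.sq_sqrt hκ, Real.sq_sqrt hn,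
      ← Real.rpow_natCast ((β - α) ^ σ) 2, ← Real.rpow_mul hh.le]
    push_cast
    rw [mul_comm σ 2]
    calc _ ≤ ‖G‖ ^ 2 * κ * ((β - α) ^ (2 * σ) * n) := by
          gcongr
          exact integral_locK_sq_le hαβ hm
      _ = _ := by ring
  · have h := adjConst_mul_sqrt_le hr (m := m) hh.le
    calc _ = adjConst r * √κ * ((β - α) ^ σ * √n) := by ring
      _ ≤ 5 * (3 / 4) ^ r * ((β - α) ^ (r + m) * √(β - α)) * ((β - α) ^ σ * √n) := by gcongr
      _ = _ := by
          rw [Real.rpow_add hh, ← Nat.cast_add, Real.rpow_natCast]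
          ring

lemma gagliardoSq_mono {F : Type*} [NormedAddCommGroup F] {a b a' b' : ℝ}
    (h : Ioo a b ⊆ Ioo a' b') (σ : ℝ) (g : ℝ → F) :
    gagliardoSq a b σ g ≤ gagliardoSq a' b' σ g :=
  (lintegral_mono_set h).trans (lintegral_mono fun _ => lintegral_mono_set h)

/-- The inner integral is enlarged from the step to `(0, T)`; the outer ones then run over disjoint
sets. -/
lemma IsPartition.sum_gagliardoSq_le {F : Type*} [NormedAddCommGroup F] {N : ℕ}
    {t : Fin (N + 1) → ℝ} (ht : IsPartition T t) (σ : ℝ) (g : ℝ → F) :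
    ∑ k : Fin N, gagliardoSq (t k.castSucc) (t k.succ) σ g ≤ gagliardoSq 0 T σ g :=
  (Finset.sum_le_sum fun k _ => lintegral_mono fun _ => lintegral_mono_set
    (ht.Ioo_subset k)).trans (ht.sum_lintegral_le _)

lemma hsNorm_sq (a b : ℝ) (u : ℝ → E) : hsNorm a b s u ^ 2 =
    (∑ j ∈ Finset.range (⌊s⌋₊ + 1), ∫ x in Ioo a b, ‖weakDeriv a b j u x‖ ^ 2) +
    if Int.fract s = 0 then 0
    else (gagliardoSq a b (Int.fract s) (weakDeriv a b ⌊s⌋₊ u)).toReal := by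
  rw [hsNorm, Real.sq_sqrt]
  refine add_nonneg (Finset.sum_nonneg fun j _ => integral_nonneg fun x => by positivity) ?_
  split_ifs
  · exact le_rfl
  · exact ENNReal.toReal_nonneg

lemma integral_weakDeriv_sq_le_hsNorm_sq (a b : ℝ) (u : ℝ → E) {j : ℕ} (hj : j ≤ ⌊s⌋₊) :
    ∫ x in Ioo a b, ‖weakDeriv a b j u x‖ ^ 2 ≤ hsNorm a b s u ^ 2 := by
  rw [hsNorm_sq]
  have h1 := Finset.single_le_sum
    (f := fun j => ∫ x in Ioo a b, ‖weakDeriv a b j u x‖ ^ 2)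
    (fun j _ => integral_nonneg fun x => by positivity)
    (Finset.mem_range.2 (Nat.lt_succ_of_le hj))
  refine h1.trans (le_add_of_nonneg_right ?_)
  split_ifs
  · exact le_rfl
  · exact ENNReal.toReal_nonneg

lemma gagliardoSq_toReal_le_hsNorm_sq (a b : ℝ) (u : ℝ → E) (hs : Int.fract s ≠ 0) :
    (gagliardoSq a b (Int.fract s) (weakDeriv a b ⌊s⌋₊ u)).toReal ≤ hsNorm a b s u ^ 2 := by
  rw [hsNorm_sq, if_neg hs]
  exact le_add_of_nonneg_left (Finset.sum_nonneg fun j _ => integral_nonneg fun x => by positivity)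

lemma MemHs.memLp_of_subset {v : ℝ → E} (h : MemHs 0 T s v) {j : ℕ} (hj : j ≤ ⌊s⌋₊) {α β : ℝ}
    (hsub : Ioo α β ⊆ Ioo 0 T) :
    MemLp (weakDeriv 0 T j v) 2 (volume.restrict (Ioo α β)) :=
  (h.1 j hj).2.mono_measure (Measure.restrict_mono hsub le_rfl)

/-- The step constants in terms of a local energy `n` that is superadditive over partitions,
when the full order of regularity used is an integer. -/
lemma MemHs.exists_energy_integer [CompleteSpace E] (h : MemHs 0 T s v) (hT : 0 < T) {r m : ℕ}
    (hr : 1 ≤ r) (hm : m ≤ r) (hms : m + 1 ≤ ⌊s⌋₊) :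
    ∃ n : ℝ → ℝ → ℝ≥0∞, n 0 T ≠ ⊤ ∧ (n 0 T).toReal ≤ hsNorm 0 T s v ^ 2 ∧
      (∀ (N : ℕ) (t : Fin (N + 1) → ℝ), IsPartition T t →
        ∑ k : Fin N, n (t k.castSucc) (t k.succ) ≤ n 0 T) ∧
      ∀ α β, 0 ≤ α → α < β → β ≤ T → ∃ δ, 0 ≤ δ ∧
        (∀ G, |∫ x in α..β, inner ℝ (weakDeriv 0 T 1 v x) G * (locK α β r r).eval x| ≤ δ * ‖G‖) ∧
        δ * adjConst r ≤ 5 * (3 / 4) ^ r * (β - α) ^ ((r : ℝ) + m) *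
          (√(β - α) * √(n α β).toReal) := by
  set g := weakDeriv 0 T (m + 1) v
  have hint : ∀ α β, Ioo α β ⊆ Ioo 0 T → ENNReal.ofReal (∫ x in Ioo α β, ‖g x‖ ^ 2) =
      ∫⁻ x in Ioo α β, ENNReal.ofReal (‖g x‖ ^ 2) := fun α β hsub =>
    ofReal_integral_eq_lintegral_ofReal
      ((h.memLp_of_subset hms hsub).integrable_norm_pow (by norm_num))
      (Filter.Eventually.of_forall fun y => by positivity)
  have hreal : ∀ α β, Ioo α β ⊆ Ioo 0 T →
      (∫⁻ x in Ioo α β, ENNReal.ofReal (‖g x‖ ^ 2)).toReal = ∫ x in Ioo α β, ‖g x‖ ^ 2 :=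
    fun α β hsub => by
      rw [← hint α β hsub, ENNReal.toReal_ofReal (integral_nonneg fun x => by positivity)]
  refine ⟨fun α β => ∫⁻ x in Ioo α β, ENNReal.ofReal (‖g x‖ ^ 2), ?_, ?_, ?_, ?_⟩
  · simp only
    rw [← hint 0 T subset_rfl]
    exact ENNReal.ofReal_ne_top
  · simp only
    rw [hreal 0 T subset_rfl]
    exact integral_weakDeriv_sq_le_hsNorm_sq 0 T v hms
  · exact fun N t ht => ht.sum_lintegral_le _
  · intro α β hα hαβ hβ
    have hsub : Ioo α β ⊆ Ioo 0 T := Ioo_subset_Ioo hα hβ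
    have := exists_step_bound hαβ hr hm (σ := 0) (n := ∫ x in Ioo α β, ‖g x‖ ^ 2)
      (integral_nonneg fun x => by positivity)
      (X := fun G => ∫ x in α..β, inner ℝ (weakDeriv 0 T 1 v x) G * (locK α β r r).eval x) ?_
    · rw [add_zero, ← hreal α β hsub] at this
      exact this
    · intro G
      rw [h.integral_weakDeriv_mul_locK hT hα hαβ hβ G hm hms, mul_pow, ← pow_mul,
        mul_comm m 2, Even.neg_one_pow (even_two_mul m), one_mul, mul_zero, Real.rpow_zero, one_mul]
      exact sq_integral_inner_mul_le hαβ.le (h.memLp_of_subset hms hsub) G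
        (locK α β r (r + m)).continuous

/-- The step constants in terms of the local Gagliardo seminorm. -/
lemma MemHs.exists_energy_fractional [CompleteSpace E] (h : MemHs 0 T s v) (hT : 0 < T) {r m : ℕ}
    (hr : 1 ≤ r) (hm : m < r) (hms : m + 1 = ⌊s⌋₊) (hs : Int.fract s ≠ 0) :
    ∃ n : ℝ → ℝ → ℝ≥0∞, n 0 T ≠ ⊤ ∧ (n 0 T).toReal ≤ hsNorm 0 T s v ^ 2 ∧
      (∀ (N : ℕ) (t : Fin (N + 1) → ℝ), IsPartition T t →
        ∑ k : Fin N, n (t k.castSucc) (t k.succ) ≤ n 0 T) ∧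
      ∀ α β, 0 ≤ α → α < β → β ≤ T → ∃ δ, 0 ≤ δ ∧
        (∀ G, |∫ x in α..β, inner ℝ (weakDeriv 0 T 1 v x) G * (locK α β r r).eval x| ≤ δ * ‖G‖) ∧
        δ * adjConst r ≤ 5 * (3 / 4) ^ r * (β - α) ^ ((r : ℝ) + m + Int.fract s) *
          (√(β - α) * √(n α β).toReal) := by
  have hfin := h.2 hs
  refine ⟨fun α β => gagliardoSq α β (Int.fract s) (weakDeriv 0 T ⌊s⌋₊ v), hfin.ne,
    gagliardoSq_toReal_le_hsNorm_sq 0 T v hs, fun N t ht => ht.sum_gagliardoSq_le _ _, ?_⟩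
  intro α β hα hαβ hβ
  have hsub : Ioo α β ⊆ Ioo 0 T := Ioo_subset_Ioo hα hβ
  refine exists_step_bound hαβ hr hm.le ENNReal.toReal_nonneg fun G => ?_
  -- The strict inequality `m < r` matters: `K_{r+m+1}` must still belong to the range where both
  -- endpoint values vanish.
  have hK : ∫ x in α..β, (locK α β r (r + m)).eval x = 0 := by
    have hz := eval_locK_endpoints hαβ (r := r) (l := r + m + 1) (by omega) (by omega)
    rw [← derivative_locK_succ hαβ (by omega), intervalIntegral.integral_eq_sub_of_hasDerivAt
      (fun x _ => (locK α β r (r + m + 1)).hasDerivAt x) (intervalIntegrable_eval _ _ _),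
      hz.1, hz.2, sub_zero]
  rw [h.integral_weakDeriv_mul_locK hT hα hαβ hβ G hm.le hms.le, mul_pow, ← pow_mul,
    mul_comm m 2, Even.neg_one_pow (even_two_mul m), one_mul, hms]
  exact sq_integral_inner_mul_le_gagliardo hαβ (Int.fract_nonneg s)
    (h.memLp_of_subset le_rfl hsub) ((gagliardoSq_mono hsub _ _).trans_lt hfin).ne G
    (locK α β r (r + m)).continuous hK

/-- At most `r` derivatives can be moved, since the usable primitives end at `K_{2r}`. If `⌊s⌋ ≥ r +
1` all `r` are moved, giving the exponent `2r`. Otherwise `m = ⌊s⌋ - 1 < r` are moved, and with the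
fractional part the exponent is `s + r - 1`. -/
lemma MemHs.exists_energy [CompleteSpace E] (hs : 1 ≤ s) (h : MemHs 0 T s v) (hT : 0 < T) {r : ℕ}
    (hr : 1 ≤ r) :
    ∃ n : ℝ → ℝ → ℝ≥0∞, n 0 T ≠ ⊤ ∧ (n 0 T).toReal ≤ hsNorm 0 T s v ^ 2 ∧
      (∀ (N : ℕ) (t : Fin (N + 1) → ℝ), IsPartition T t →
        ∑ k : Fin N, n (t k.castSucc) (t k.succ) ≤ n 0 T) ∧
      ∀ α β, 0 ≤ α → α < β → β ≤ T → ∃ δ, 0 ≤ δ ∧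
        (∀ G, |∫ x in α..β, inner ℝ (weakDeriv 0 T 1 v x) G * (locK α β r r).eval x| ≤ δ * ‖G‖) ∧
        δ * adjConst r ≤ 5 * (3 / 4) ^ r * (β - α) ^ min (2 * (r : ℝ)) (s + (r : ℝ) - 1) *
          (√(β - α) * √(n α β).toReal) := by
  have hfl : (⌊s⌋₊ : ℝ) + Int.fract s = s := by
    rw [natCast_floor_eq_intCast_floor (by linarith)]
    exact Int.floor_add_fract s
  have hfl1 : 1 ≤ ⌊s⌋₊ := Nat.le_floor (by exact_mod_cast hs)
  have hfr := Int.fract_lt_one s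
  have hfr0 := Int.fract_nonneg s
  rcases le_or_gt (r + 1) ⌊s⌋₊ with hrs | hrs
  · have hmin : min (2 * (r : ℝ)) (s + (r : ℝ) - 1) = (r : ℝ) + r := by
      have : (r : ℝ) + 1 ≤ ⌊s⌋₊ := by exact_mod_cast hrs
      rw [min_eq_left (by linarith)]
      ring
    rw [hmin]
    exact h.exists_energy_integer hT hr le_rfl hrs
  · obtain ⟨m, hm⟩ := Nat.exists_eq_add_of_le' hfl1
    have hmR : (⌊s⌋₊ : ℝ) = m + 1 := by exact_mod_cast hm
    have hrR : (m : ℝ) + 1 ≤ r := by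
      have : m + 1 ≤ r := by omega
      exact_mod_cast this
    have hmin : min (2 * (r : ℝ)) (s + (r : ℝ) - 1) = (r : ℝ) + m + Int.fract s := by
      rw [min_eq_right (by linarith)]
      linarith
    rw [hmin]
    by_cases hf : Int.fract s = 0
    · rw [hf, add_zero]
      exact h.exists_energy_integer hT hr (by omega) hm.ge
    · exact h.exists_energy_fractional hT hr (by omega) hm.symm hf

end MainTheorem

theorem mainTheorem4 (s : ℝ) (hs : 1 ≤ s) :
    ∃ C : ℝ, 0 < C ∧
      ∀ (M r N : ℕ) (hr : 1 ≤ r) (T : ℝ) (hT : 0 < T)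
        (D : Matrix (Fin M) (Fin M) ℝ) (hD : (-(D + D.transpose)).PosSemidef)
        (R : ℝ → EuclideanSpace ℝ (Fin M)) (hR : MemLp R 2 (volume.restrict (Ioo 0 T)))
        (Y₀ : EuclideanSpace ℝ (Fin M)) (Y : ℝ → EuclideanSpace ℝ (Fin M))
        (hY : IsODESolution T D R Y₀ Y)
        (hreg : MemHs 0 T s (fun x => (D ^ r).toEuclideanLin (Y x)))
        (t : Fin (N + 1) → ℝ) (ht : IsPartition T t)
        (Yr : ℝ → EuclideanSpace ℝ (Fin M)) (hYr : IsCTGSolution T t r D R Y₀ Yr)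
        (n : Fin N),
        ‖Y (t n.succ) - Yr (t n.succ)‖ ≤
          C * T ^ (1 / 2 : ℝ) *
            (maxStep t ^ min (2 * (r : ℝ)) (s + (r : ℝ) - 1) / (r : ℝ) ^ s) *
            hsNorm 0 T s (fun x => (D ^ r).toEuclideanLin (Y x)) := by
  obtain ⟨C, hC0, hC⟩ := exists_rpow_mul_geometric_le s
  refine ⟨C, hC0, ?_⟩
  intro M r N hr T hT D hD R hR Y₀ Y hY hreg t ht Yr hYr n
  obtain ⟨hYac, hY0, hY'⟩ := hY
  obtain ⟨⟨hYrc, hYrp⟩, hYr0, hYr'⟩ := hYr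
  set A := D.toEuclideanLin with hAdef
  have hAr : (D ^ r).toEuclideanLin = A ^ r := Matrix.toLpLin_pow 2 D r
  rw [hAr] at hreg ⊢
  set v := fun x => (A ^ r) (Y x)
  set ρ := min (2 * (r : ℝ)) (s + (r : ℝ) - 1)
  have hρ : 0 ≤ ρ := le_min (by positivity) (by
    have : (0 : ℝ) ≤ r := by positivity
    linarith)
  obtain ⟨e, hetop, hele, hesum, hestep⟩ := hreg.exists_energy hs hT hr
  have hRi : IntegrableOn R (Ioo 0 T) := hR.integrable (by norm_num)
  have hYc : ContinuousOn Y (Icc 0 T) := by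
    simpa [uIcc_of_le hT.le] using hYac.continuousOn
  have hvi : IntegrableOn v (Ioo 0 T) :=
    (((LinearMap.continuous_of_finiteDimensional (A ^ r)).comp_continuousOn
      hYc).integrableOn_Icc).mono_set Ioo_subset_Icc_self
  have h1s : 1 ≤ ⌊s⌋₊ := Nat.le_floor (by exact_mod_cast hs)
  -- The classical derivative `A^r Y'` agrees almost everywhere with the first weak derivative of
  -- `A^r Y`, linking the error identity to the Sobolev norm.
  have hae : ∀ G, ∀ᵐ x ∂(volume.restrict (Ioo 0 T)),
      inner ℝ ((A ^ r) (A (Y x) + R x)) G = inner ℝ (weakDeriv 0 T 1 v x) G := by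
    intro G
    have hadj : ∀ w, inner ℝ ((A ^ r) w) G = inner ℝ w (LinearMap.adjoint (A ^ r) G) := fun w =>
      (LinearMap.adjoint_inner_right (A ^ r) w G).symm
    refine ae_eq_inner_weakDeriv_one hT (hreg.isWeakDeriv h1s) hvi (hreg.integrableOn h1s) G ?_ ?_
    · simp only [v, hadj]
      exact hYac.inner_const _
    · simp only [v, hadj]
      filter_upwards [hY'] with x hx
      simpa using hx.inner ℝ (hasDerivAt_const x (LinearMap.adjoint (A ^ r) G))
  have hstep : ∀ k : Fin N, ‖Y (t k.succ) - Yr (t k.succ)‖ ≤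
      ‖Y (t k.castSucc) - Yr (t k.castSucc)‖ + 5 * (3 / 4) ^ r * maxStep t ^ ρ *
        (√(t k.succ - t k.castSucc) * √(e (t k.castSucc) (t k.succ)).toReal) := by
    intro k
    have hk : t k.castSucc < t k.succ := ht.1 Fin.castSucc_lt_succ
    have hk0 : 0 ≤ t k.castSucc := by
      rw [← ht.2.1]; exact ht.1.monotone (Fin.zero_le _)
    have hkT : t k.succ ≤ T := by
      rw [← ht.2.2]; exact ht.1.monotone (Fin.le_last _)
    have hsub := ht.Ioo_subset k
    obtain ⟨δ, hδ0, hδ, hδA⟩ := hestep _ _ hk0 hk hkT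
    obtain ⟨p, q, hp, hq, hpq⟩ := hYr' k
    have hYk : AbsolutelyContinuousOnInterval Y (t k.castSucc) (t k.succ) := by
      refine hYac.mono ?_
      rw [uIcc_of_le hk.le, uIcc_of_le hT.le]
      exact Icc_subset_Icc hk0 hkT
    refine (galerkin_step_error hk hr (inner_toEuclideanLin_self_nonpos hD)
      (hRi.mono_set hsub) hYk (ae_restrict_of_ae_restrict_of_subset hsub hY')
      (hYrc.mono (Icc_subset_Icc hk0 hkT)) (hYrp k) hp hq hpq hδ0 fun G => ?_).trans ?_
    · refine le_of_eq_of_le ?_ (hδ G)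
      rw [intervalIntegral_eq_setIntegral_Ioo hk.le, intervalIntegral_eq_setIntegral_Ioo hk.le]
      congr 1
      refine integral_congr_ae ?_
      filter_upwards [ae_restrict_of_ae_restrict_of_subset hsub (hae G)] with x hx
      rw [hx]
    · refine add_le_add_right (hδA.trans ?_) _
      have hk' : 0 ≤ t k.succ - t k.castSucc := by linarith
      gcongr
      · exact step_le_maxStep t k
  set F : Fin N → ℝ := fun k =>
    √(t k.succ - t k.castSucc) * √(e (t k.castSucc) (t k.succ)).toReal
  have hF0 : ∀ k, 0 ≤ F k := fun k => by positivity
  have hτ : 0 ≤ maxStep t := by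
    have := ht.1 (Fin.castSucc_lt_succ (i := n))
    linarith [step_le_maxStep t n]
  set Q := 5 * (3 / 4 : ℝ) ^ r * maxStep t ^ ρ
  have hQ0 : 0 ≤ Q := by positivity
  -- The error vanishes at time 0 and is propagated with factor one, so the step contributions
  -- simply accumulate.
  have hind : ∀ i : Fin (N + 1), ‖Y (t i) - Yr (t i)‖ ≤
      ∑ k : Fin N with k.castSucc < i, Q * F k := by
    intro i
    induction i using Fin.induction with
    | zero => simp [ht.2.1, hY0, hYr0]
    | succ i ih =>
      have hset : (Finset.univ.filter fun k : Fin N => k.castSucc < i.succ) =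
          insert i (Finset.univ.filter fun k : Fin N => k.castSucc < i.castSucc) := by
        ext k
        simp only [Finset.mem_filter, Finset.mem_univ, true_and, Finset.mem_insert,
          Fin.castSucc_lt_succ_iff, Fin.castSucc_lt_castSucc_iff]
        exact le_iff_eq_or_lt
      rw [hset, Finset.sum_insert (by simp)]
      linarith [hstep i]
  have hfin : ∀ k : Fin N, e (t k.castSucc) (t k.succ) ≠ ⊤ := fun k =>
    ((Finset.single_le_sum (f := fun k : Fin N => e (t k.castSucc) (t k.succ))
      (fun _ _ => zero_le) (Finset.mem_univ k)).trans (hesum N t ht)).trans_lt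
      hetop.lt_top |>.ne
  -- Cauchy–Schwarz over the steps: the lengths add up to `T`, the energies to at most the squared
  -- norm.
  have hsumF : ∑ k, F k ≤ √T * hsNorm 0 T s v := by
    refine (Real.sum_sqrt_mul_sqrt_le Finset.univ (fun k => ?_)
      fun k => ENNReal.toReal_nonneg).trans ?_
    · have := ht.1 (Fin.castSucc_lt_succ (i := k))
      linarith
    · rw [ht.sum_step, ← ENNReal.toReal_sum fun k _ => hfin k]
      gcongr
      refine Real.sqrt_le_iff.2 ⟨Real.sqrt_nonneg _, ?_⟩
      exact (ENNReal.toReal_mono hetop (hesum N t ht)).trans hele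
  have hH : 0 ≤ hsNorm 0 T s v := Real.sqrt_nonneg _
  calc ‖Y (t n.succ) - Yr (t n.succ)‖ ≤ ∑ k : Fin N with k.castSucc < n.succ, Q * F k := hind _
    _ ≤ ∑ k, Q * F k := Finset.sum_le_sum_of_subset_of_nonneg (Finset.filter_subset _ _)
        fun k _ _ => mul_nonneg hQ0 (hF0 k)
    _ = Q * ∑ k, F k := (Finset.mul_sum _ _ _).symm
    _ ≤ Q * (√T * hsNorm 0 T s v) := by gcongr
    _ ≤ (C / (r : ℝ) ^ s * maxStep t ^ ρ) * (√T * hsNorm 0 T s v) := by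
        refine mul_le_mul_of_nonneg_right ?_ (by positivity)
        exact mul_le_mul_of_nonneg_right (hC r hr) (Real.rpow_nonneg hτ _)
    _ = _ := by
        rw [← Real.sqrt_eq_rpow]
        ring
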